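/- For a binary form $F(x,y)$ with rational coefficients and a rational matrix $M=\left(\begin{smallmatrix}s&u\\t&v\end{smallmatrix}\right)$ put $F_M(x,y)=F(sx+uy,\,tx+vy)$. Let $\operatorname{Aut}F$ be the set of all $2\times2$ matrices $M$ with rational entries such that $F_M=F$, and $\operatorname{Aut}|F|$ the set of those such that $F_M=F$ or $F_M=-F$. Let $I$ be the $2\times 2$ identity matrix and let $$\mathbf C_1=\langle I\rangle,\quad \mathbf C_2=\langle -I\rangle,\quad \mathbf C_3=\left\langle\begin{pmatrix}0&1\\-1&-1\end{pmatrix}\right\rangle,\quad \mathbf C_4=\left\langle\begin{pmatrix}0&1\\-1&0\end{pmatrix}\right\rangle,\quad \mathbf C_6=\left\langle\begin{pmatrix}0&-1\\1&1\end{pmatrix}\right\rangle,$$ $$\mathbf D_2=\left\langle\begin{pmatrix}0&1\\1&0\end{pmatrix},-I\right\rangle,\quad \mathbf D_4=\left\langle\begin{pmatrix}0&1\\1&0\end{pmatrix},\begin{pmatrix}0&1\\-1&0\end{pmatrix}\right\rangle,$$ as subgroups of $\operatorname{GL}_2(\mathbb Q)$. For a positive integer $n$ let $\Pi_n(x)$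 be the minimal polynomial of $2\sin(2\pi/n)$ over $\mathbb Q$ and let $\Pi_n(x,y)$ be its homogenization, $\Pi_n(x,y)=y^{\deg\Pi_n}\,\Pi_n(x/y)$. Let $n$ be a positive integer with $n\notin\{1,2,3,4,6,8,12,20\}$, and let $$d=\begin{cases}\varphi(n)&\text{if }\gcd(n,8)<4,\\ \varphi(n)/4&\text{if }\gcd(n,8)=4,\\ \varphi(n)/2&\text{if }\gcd(n,8)>4.\end{cases}$$ Then $\deg\Pi_n=d$ and $d\ge3$, and the following hold. 1. If $n\equiv4\pmod 8$ and $d\ge5$ is odd, then $\operatorname{Aut}\Pi_n=\{I\}\cong\mathbf C_1$ and $\operatorname{Aut}|\Pi_n|=\{\pm I\}\cong\mathbf C_2$. 2. If $n\equiv4\pmod 8$ and $d\ge6$ is even, then $\operatorname{Aut}\Pi_n=\operatorname{Aut}|\Pi_n|=\{\pm I\}\cong\mathbf C_2$. 3. If $n\not\equiv4\pmod 8$ and $n\ne24$, then $\operatorname{Aut}\Pi_n=\left\langle\begin{pmatrix}-1&0\\0&1\end{pmatrix},\begin{pmatrix}1&0\\0&-1\end{pmatrix}\right\rangle\cong\mathbf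 D_2$. 4. (a) If $n\in\{28,36\}$, then $\operatorname{Aut}\Pi_n=\left\langle\begin{pmatrix}-1&1\\-1&0\end{pmatrix}\right\rangle$ is $\operatorname{GL}_2(\mathbb Q)$-conjugate to $\mathbf C_3$, and $\operatorname{Aut}|\Pi_n|=\left\langle\begin{pmatrix}-1&1\\-1&0\end{pmatrix},-I\right\rangle$ is $\operatorname{GL}_2(\mathbb Q)$-conjugate to $\mathbf C_6$. (b) If $n=60$, then $\operatorname{Aut}\Pi_n=\operatorname{Aut}|\Pi_n|=\left\langle\begin{pmatrix}1&2\\-1&-1\end{pmatrix}\right\rangle$ is $\operatorname{GL}_2(\mathbb Q)$-conjugate to $\mathbf C_4$. (c) If $n=24$, then $\operatorname{Aut}\Pi_n=\operatorname{Aut}|\Pi_n|=\left\langle\begin{pmatrix}0&1\\1&0\end{pmatrix},\begin{pmatrix}0&1\\-1&0\end{pmatrix}\right\rangle=\mathbf D_4$; in particular both are $\operatorname{GL}_2(\mathbb Q)$-conjugate to $\mathbf D_4$. -/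

import Mathlib

open Matrix

noncomputable section

/-- The form `F_M(x, y) = F(s x + u y, t x + v y)` for `M = !![s, u; t, v]`: each variable `X i`
is replaced by the linear form `M i 0 * X 0 + M i 1 * X 1`. -/
def formSubst (F : MvPolynomial (Fin 2) ℚ) (M : Matrix (Fin 2) (Fin 2) ℚ) :
    MvPolynomial (Fin 2) ℚ :=
  MvPolynomial.bind₁
    (fun i => MvPolynomial.C (M i 0) * MvPolynomial.X 0 + MvPolynomial.C (M i 1) * MvPolynomial.X 1)
    F

theorem formSubst_one (F : MvPolynomial (Fin 2) ℚ) : formSubst F 1 = F := by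
  have h : (fun i : Fin 2 => MvPolynomial.C ((1 : Matrix (Fin 2) (Fin 2) ℚ) i 0) *
      MvPolynomial.X 0 + MvPolynomial.C ((1 : Matrix (Fin 2) (Fin 2) ℚ) i 1) * MvPolynomial.X 1)
      = MvPolynomial.X := by
    funext i
    fin_cases i <;> simp [Matrix.one_apply]
  rw [formSubst, h, MvPolynomial.bind₁_X_left, AlgHom.id_apply]

theorem formSubst_mul (F : MvPolynomial (Fin 2) ℚ) (M N : Matrix (Fin 2) (Fin 2) ℚ) :
    formSubst F (M * N) = formSubst (formSubst F M) N := by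
  unfold formSubst
  rw [MvPolynomial.bind₁_bind₁]
  congr 2
  funext i
  simp only [map_add, map_mul, MvPolynomial.bind₁_C_right, MvPolynomial.bind₁_X_right,
    Matrix.mul_apply, Fin.sum_univ_two]
  ring

theorem formSubst_neg (F : MvPolynomial (Fin 2) ℚ) (M : Matrix (Fin 2) (Fin 2) ℚ) :
    formSubst (-F) M = -formSubst F M := by
  simp [formSubst]

/-- `Aut F`: all `2 × 2` matrices `M` with rational entries such that `F_M = F`.
Invertibility of `M` is not part of the definition. -/
def formAut (F : MvPolynomial (Fin 2) ℚ) : Submonoid (Matrix (Fin 2) (Fin 2) ℚ) where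
  carrier := {M | formSubst F M = F}
  one_mem' := formSubst_one F
  mul_mem' := by
    intro M N hM hN
    simp only [Set.mem_ofPred_eq] at hM hN ⊢
    rw [formSubst_mul, hM, hN]

/-- `Aut |F|`: all `2 × 2` matrices `M` with rational entries such that `F_M = F` or
`F_M = -F`. -/
def formAbsAut (F : MvPolynomial (Fin 2) ℚ) : Submonoid (Matrix (Fin 2) (Fin 2) ℚ) where
  carrier := {M | formSubst F M = F ∨ formSubst F M = -F}
  one_mem' := Or.inl (formSubst_one F)
  mul_mem' := by
    intro M N hM hN
    simp only [Set.mem_ofPred_eq] at hM hN ⊢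
    rw [formSubst_mul]
    rcases hM with hM | hM <;> rcases hN with hN | hN <;> simp [hM, hN, formSubst_neg]

/-- The subgroup of `GL₂(ℚ)` generated by a set of (invertible) matrices. -/
def glSpan (S : Set (Matrix (Fin 2) (Fin 2) ℚ)) : Subgroup (GL (Fin 2) ℚ) :=
  Subgroup.closure {g | (g : Matrix (Fin 2) (Fin 2) ℚ) ∈ S}

/-- A subgroup of `GL₂(ℚ)`, regarded as a set of matrices closed under multiplication. -/
def glMatrices (G : Subgroup (GL (Fin 2) ℚ)) : Submonoid (Matrix (Fin 2) (Fin 2) ℚ) :=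
  G.toSubmonoid.map (Units.coeHom (Matrix (Fin 2) (Fin 2) ℚ))

/-- `A` is a subgroup of `GL₂(ℚ)` that is `GL₂(ℚ)`-conjugate to `G`. -/
def IsGLConj (A : Submonoid (Matrix (Fin 2) (Fin 2) ℚ)) (G : Subgroup (GL (Fin 2) ℚ)) : Prop :=
  ∃ S : GL (Fin 2) ℚ, A = glMatrices (G.map (MulAut.conj S).toMonoidHom)

/-! The standard representatives of conjugacy classes of finite subgroups of `GL₂(ℚ)`. -/

def groupC1 : Subgroup (GL (Fin 2) ℚ) := glSpan {!![1, 0; 0, 1]}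

def groupC2 : Subgroup (GL (Fin 2) ℚ) := glSpan {!![-1, 0; 0, -1]}

def groupC3 : Subgroup (GL (Fin 2) ℚ) := glSpan {!![0, 1; -1, -1]}

def groupC4 : Subgroup (GL (Fin 2) ℚ) := glSpan {!![0, 1; -1, 0]}

def groupC6 : Subgroup (GL (Fin 2) ℚ) := glSpan {!![0, -1; 1, 1]}

def groupD2 : Subgroup (GL (Fin 2) ℚ) := glSpan {!![0, 1; 1, 0], !![-1, 0; 0, -1]}

def groupD4 : Subgroup (GL (Fin 2) ℚ) := glSpan {!![0, 1; 1, 0], !![0, 1; -1, 0]}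

/-- The minimal polynomial `Π_n(x)` of `2 sin(2π/n)` over `ℚ`. -/
def sinPoly (n : ℕ) : Polynomial ℚ := minpoly ℚ (2 * Real.sin (2 * Real.pi / n))

/-- The binary form `Π_n(x, y)`: the homogenization of `Π_n(x)`, with `x = X 0`, `y = X 1`. -/
def sinForm (n : ℕ) : MvPolynomial (Fin 2) ℚ := (sinPoly n).homogenize (sinPoly n).natDegree

/-- The value `d` of the degree of `Π_n` for `n ∉ {1, 2, 4}`; both divisions are exact there. -/
def sinDegree (n : ℕ) : ℕ :=
  if Nat.gcd n 8 < 4 then Nat.totient n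
  else if Nat.gcd n 8 = 4 then Nat.totient n / 4
  else Nat.totient n / 2

end

/-! A matrix `M` in `Aut |Π_n|` acts as a Möbius transformation permuting the conjugates of
`α = 2 sin (2π/n) = ζ + ζ⁻¹`, and, when `deg Π_n ≥ 3`, is determined up to sign by the image of
`α`. If `M` maps `α` to `τ α` with `τ` in the Galois group of `ℚ(ζ)`, then, this group being
abelian, `M` maps every conjugate `γ` of `α` to `τ γ`; so, at `α`, the action of `M` commutes with
every rational function that maps `α` to one of its conjugates.

If `n ≡ 4 (mod 8)`, then `4` does not divide the order of `ζ` and such a function is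
`x ↦ ± (x² - 2)`; comparing coefficients forces `M` to be scalar as soon as `deg Π_n ≥ 5`.
Otherwise `x ↦ -x` is one, so `M` is diagonal or antidiagonal; in the antidiagonal case
`γ τ(γ)` would be the same rational number for all conjugates `γ`, which fails except for `n = 24`.
The remaining forms, of degree `3` or `4`, are treated through explicit formulas for the roots. -/

section Moebius

variable {K L : Type*} [Field K] [Field L] {α β γ : K} {M N : Matrix (Fin 2) (Fin 2) ℚ}

/-- The Möbius transformation `z ↦ (s z + u) / (t z + v)` of `M = !![s, u; t, v]` is defined at `α`
and maps it to `β`. -/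
def MoebiusMaps (M : Matrix (Fin 2) (Fin 2) ℚ) (α β : K) : Prop :=
  (M 1 0 : K) * α + M 1 1 ≠ 0 ∧ (M 0 0 : K) * α + M 0 1 = β * ((M 1 0 : K) * α + M 1 1)

namespace MoebiusMaps

theorem right_unique (hβ : MoebiusMaps M α β) (hγ : MoebiusMaps M α γ) : β = γ :=
  mul_right_cancel₀ hβ.1 (hβ.2.symm.trans hγ.2)

theorem map (h : MoebiusMaps M α β) (σ : K →+* L) : MoebiusMaps M (σ α) (σ β) :=
  ⟨by simpa using (map_ne_zero σ).mpr h.1, by simpa using congrArg σ h.2⟩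

variable [CharZero K]

theorem one (α : K) : MoebiusMaps 1 α α := by
  simp [MoebiusMaps]

theorem mul (hM : MoebiusMaps M β γ) (hN : MoebiusMaps N α β) : MoebiusMaps (M * N) α γ := by
  obtain ⟨hM₀, hM⟩ := hM
  obtain ⟨hN₀, hN⟩ := hN
  have hden : ((M * N) 1 0 : K) * α + ((M * N) 1 1 : ℚ) =
      ((M 1 0 : K) * β + M 1 1) * ((N 1 0 : K) * α + N 1 1) := by
    simp only [Matrix.mul_apply, Fin.sum_univ_two, Rat.cast_add, Rat.cast_mul]
    linear_combination (M 1 0 : K) * hN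
  refine ⟨hden ▸ mul_ne_zero hM₀ hN₀, ?_⟩
  rw [hden]
  simp only [Matrix.mul_apply, Fin.sum_univ_two, Rat.cast_add, Rat.cast_mul]
  linear_combination (M 0 0 : K) * hN + ((N 1 0 : K) * α + N 1 1) * hM

theorem det_ne_zero (h : MoebiusMaps M α β) (hβ : ∀ q : ℚ, β ≠ q) : M.det ≠ 0 := by
  obtain ⟨h₀, h⟩ := h
  intro hdet
  rw [Matrix.det_fin_two, sub_eq_zero] at hdet
  have hdet' : (M 0 0 : K) * M 1 1 = M 0 1 * M 1 0 := by exact_mod_cast hdet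
  by_cases ht : M 1 0 = 0
  · simp only [ht, Rat.cast_zero, zero_mul, zero_add, mul_zero, mul_eq_zero] at h₀ h hdet'
    refine hβ (M 0 1 / M 1 1) ?_
    rw [Rat.cast_div, eq_div_iff h₀, ← h, hdet'.resolve_right h₀, zero_mul, zero_add]
  · have ht' : (M 1 0 : K) ≠ 0 := Rat.cast_ne_zero.mpr ht
    refine hβ (M 0 0 / M 1 0) (mul_right_cancel₀ h₀ ?_)
    rw [← h, Rat.cast_div, div_mul_eq_mul_div, eq_div_iff ht']
    linear_combination -hdet'

theorem of_mul_eq_one (h : MoebiusMaps M α β) (hNM : N * M = 1) : MoebiusMaps N β α := by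
  obtain ⟨h₀, h⟩ := h
  have hentry (i j : Fin 2) : (N i 0 : K) * M 0 j + N i 1 * M 1 j =
      ((1 : Matrix (Fin 2) (Fin 2) ℚ) i j : ℚ) := by
    rw [← hNM, Matrix.mul_apply, Fin.sum_univ_two]
    push_cast
    rfl
  have h₁ : ((N 1 0 : K) * β + N 1 1) * ((M 1 0 : K) * α + M 1 1) = 1 := by
    have h0 := hentry 1 0
    have h1 := hentry 1 1
    simp only [Matrix.one_apply_eq, ne_eq, one_ne_zero, not_false_eq_true, Matrix.one_apply_ne,
      Rat.cast_one, Rat.cast_zero] at h0 h1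
    linear_combination -(N 1 0 : K) * h + α * h0 + h1
  have h₂ : ((N 0 0 : K) * β + N 0 1) * ((M 1 0 : K) * α + M 1 1) = α := by
    have h0 := hentry 0 0
    have h1 := hentry 0 1
    simp only [Matrix.one_apply_eq, ne_eq, zero_ne_one, not_false_eq_true, Matrix.one_apply_ne,
      Rat.cast_one, Rat.cast_zero] at h0 h1
    linear_combination -(N 0 0 : K) * h + α * h0 + h1
  refine ⟨left_ne_zero_of_mul_eq_one h₁, mul_right_cancel₀ h₀ ?_⟩
  rw [h₂, mul_assoc, h₁, mul_one]

end MoebiusMaps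

variable [CharZero K]

theorem eq_zero_of_sum_mul_pow_eq_zero {n : ℕ} (hn : n ≤ (minpoly ℚ α).natDegree) {c : Fin n → ℚ}
    (h : ∑ i, (c i : K) * α ^ (i : ℕ) = 0) : c = 0 := by
  have hli := (linearIndependent_pow (K := ℚ) α).comp _ (Fin.castLE_injective hn)
  refine funext (Fintype.linearIndependent_iff.mp hli c ?_)
  simpa [Algebra.smul_def] using h

theorem ne_ratCast_of_one_lt_natDegree (hα : 1 < (minpoly ℚ α).natDegree) (q : ℚ) : α ≠ q := by
  rintro rfl
  exact hα.ne' (minpoly.natDegree_eq_one_iff.mpr ⟨q, by simp⟩)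

theorem ratCast_mul_add_ratCast_eq_zero_iff (hα : 1 < (minpoly ℚ α).natDegree) {a b : ℚ} :
    (a : K) * α + b = 0 ↔ a = 0 ∧ b = 0 := by
  refine ⟨fun h ↦ ?_, fun ⟨ha, hb⟩ ↦ by simp [ha, hb]⟩
  have hc : ![b, a] = 0 := by
    refine eq_zero_of_sum_mul_pow_eq_zero (α := α) hα ?_
    simpa [add_comm] using h
  exact ⟨congrFun hc 1, congrFun hc 0⟩

theorem isIntegral_of_natDegree_pos (hα : 0 < (minpoly ℚ α).natDegree) : IsIntegral ℚ α := by
  by_contra h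
  simp [minpoly.eq_zero h] at hα

theorem MoebiusMaps.eq_smul_one (hα : 2 < (minpoly ℚ α).natDegree) (h : MoebiusMaps M α α) :
    M = M 0 0 • (1 : Matrix (Fin 2) (Fin 2) ℚ) := by
  have hc : ![-M 0 1, M 1 1 - M 0 0, M 1 0] = 0 := by
    refine eq_zero_of_sum_mul_pow_eq_zero (α := α) hα ?_
    simp only [Fin.sum_univ_three, Matrix.cons_val, Rat.cast_neg, Rat.cast_sub, Fin.val_zero,
      Fin.val_one, Fin.val_two, pow_zero, pow_one]
    linear_combination -h.2
  have h0 := congrFun hc 0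
  have h1 := congrFun hc 1
  have h2 := congrFun hc 2
  simp only [Matrix.cons_val, Pi.zero_apply, neg_eq_zero, sub_eq_zero] at h0 h1 h2
  ext i j
  fin_cases i <;> fin_cases j <;> simp [h0, h1, h2]

end Moebius

noncomputable section Forms

open MvPolynomial

variable {F G : MvPolynomial (Fin 2) ℚ} {M N : Matrix (Fin 2) (Fin 2) ℚ} {n : ℕ}

theorem aeval_formSubst {A : Type*} [CommRing A] [Algebra ℚ A] (F : MvPolynomial (Fin 2) ℚ)
    (M : Matrix (Fin 2) (Fin 2) ℚ) (x y : A) :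
    aeval ![x, y] (formSubst F M) = aeval ![algebraMap ℚ A (M 0 0) * x + algebraMap ℚ A (M 0 1) * y,
      algebraMap ℚ A (M 1 0) * x + algebraMap ℚ A (M 1 1) * y] F := by
  rw [formSubst, aeval_bind₁]
  congr 2
  funext i
  fin_cases i <;> simp

theorem formSubst_smul_one (hF : F.IsHomogeneous n) (c : ℚ) :
    formSubst F (c • 1) = C (c ^ n) * F := by
  have hX : (fun i : Fin 2 ↦ C ((c • (1 : Matrix (Fin 2) (Fin 2) ℚ)) i 0) * X 0 +
      C ((c • (1 : Matrix (Fin 2) (Fin 2) ℚ)) i 1) * X 1) = fun i ↦ C c * X i := by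
    funext i
    fin_cases i <;> simp
  rw [formSubst, hX]
  conv_lhs => rw [F.as_sum]
  conv_rhs => rw [F.as_sum, Finset.mul_sum]
  rw [map_sum]
  refine Finset.sum_congr rfl fun d hd ↦ ?_
  have hdeg : d 0 + d 1 = n := by
    simpa [Finsupp.weight_apply, Finsupp.sum_fintype] using hF (mem_support_iff.mp hd)
  rw [bind₁, aeval_monomial, monomial_eq, algebraMap_eq, ← hdeg]
  simp only [Finsupp.prod_fintype, pow_zero, implies_true, Fin.prod_univ_two, map_pow]
  ring

theorem neg_one_mem_formAut (hF : F.IsHomogeneous n) (hn : Even n) : -1 ∈ formAut F := by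
  change formSubst F (-1) = F
  rw [← neg_one_smul ℚ 1, formSubst_smul_one hF, hn.neg_one_pow, map_one, one_mul]

theorem neg_one_mem_formAbsAut (hF : F.IsHomogeneous n) : -1 ∈ formAbsAut F := by
  change formSubst F (-1) = F ∨ formSubst F (-1) = -F
  rw [← neg_one_smul ℚ 1, formSubst_smul_one hF]
  rcases neg_one_pow_eq_or ℚ n with h | h <;> simp [h]

theorem formAut_le_formAbsAut (F : MvPolynomial (Fin 2) ℚ) : formAut F ≤ formAbsAut F :=
  fun _ ↦ Or.inl

theorem mem_formAut_of_mul_eq_one (h : M * N = 1) (hM : M ∈ formAut F) : N ∈ formAut F := by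
  have hM : formSubst F M = F := hM
  change formSubst F N = F
  rw [← hM, ← formSubst_mul, h, formSubst_one, hM]

theorem mem_formAbsAut_of_mul_eq_one (h : M * N = 1) (hM : M ∈ formAbsAut F) :
    N ∈ formAbsAut F := by
  refine hM.imp (mem_formAut_of_mul_eq_one h) fun hM ↦ ?_
  have hN : formSubst (formSubst F M) N = F := by rw [← formSubst_mul, h, formSubst_one]
  rw [← neg_eq_iff_eq_neg, ← formSubst_neg, ← hM, hN]

theorem eq_one_or_eq_neg_one_of_smul_one_mem_formAbsAut (hF : F.IsHomogeneous n) (hF₀ : F ≠ 0)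
    (hn : n ≠ 0) {c : ℚ} (h : c • 1 ∈ formAbsAut F) : c = 1 ∨ c = -1 := by
  have h : formSubst F (c • 1) = F ∨ formSubst F (c • 1) = -F := h
  have hpow : c ^ n = 1 ∨ c ^ n = -1 := by
    rw [formSubst_smul_one hF] at h
    refine h.imp (fun h ↦ ?_) fun h ↦ ?_ <;> apply C_injective (Fin 2) ℚ <;>
      apply mul_right_cancel₀ hF₀ <;> simpa using h
  have habs : |c| ^ n = 1 := by
    rw [← abs_pow]
    rcases hpow with h | h <;> simp [h]
  exact eq_or_eq_neg_of_abs_eq ((pow_eq_one_iff_of_nonneg (abs_nonneg c) hn).mp habs)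

theorem form_ext_of_aeval (h : ∀ x y : ℚ, y ≠ 0 → aeval ![x, y] F = aeval ![x, y] G) : F = G := by
  refine mul_right_cancel₀ (X_ne_zero (1 : Fin 2)) (MvPolynomial.funext fun p ↦ ?_)
  rcases eq_or_ne (p 1) 0 with hp | hp
  · simp [hp]
  · have hpe : p = ![p 0, p 1] := by
      funext i
      fin_cases i <;> rfl
    rw [hpe, map_mul, map_mul]
    congr 1
    exact h _ _ hp

theorem aeval_homogenize {A : Type*} [Field A] [Algebra ℚ A] {p : Polynomial ℚ}
    (hp : p.natDegree ≤ n) (x : A) {y : A} (hy : y ≠ 0) :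
    aeval ![x, y] (p.homogenize n) = y ^ n * Polynomial.aeval (x / y) p := by
  have h := Polynomial.eval_homogenize (p := p.map (algebraMap ℚ A))
    (Polynomial.natDegree_map_le.trans hp) ![x, y] hy
  rw [Polynomial.homogenize_map, eval_map, Polynomial.eval_map] at h
  rw [mul_comm]
  exact h

variable {K : Type*} [Field K] [CharZero K]

theorem aeval_homogenize_right_zero (p : Polynomial ℚ) (n : ℕ) (x : K) :
    aeval ![x, 0] (p.homogenize n) = p.coeff n * x ^ n := by
  rw [Polynomial.homogenize, map_sum, Finset.Nat.sum_antidiagonal_eq_sum_range_succ_mk,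
    Finset.sum_range_succ, Finset.sum_eq_zero fun i hi ↦ ?_]
  · simp [aeval_monomial, Finsupp.prod_fintype]
  · have hi : n - i ≠ 0 := Nat.sub_ne_zero_of_lt (Finset.mem_range.mp hi)
    simp [aeval_monomial, Finsupp.prod_fintype, hi]

/-- The binary form attached to `α`: the homogenization of its minimal polynomial over `ℚ`. -/
def minpolyForm (α : K) : MvPolynomial (Fin 2) ℚ :=
  (minpoly ℚ α).homogenize (minpoly ℚ α).natDegree

variable {α β γ : K}

theorem isHomogeneous_minpolyForm (α : K) :
    (minpolyForm α).IsHomogeneous (minpoly ℚ α).natDegree :=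
  Polynomial.isHomogeneous_homogenize _

theorem minpolyForm_ne_zero (hα : IsIntegral ℚ α) : minpolyForm α ≠ 0 :=
  (Polynomial.homogenize_eq_zero_iff le_rfl).not.mpr (minpoly.ne_zero hα)

theorem exists_isConjRoot_moebiusMaps (hα : 1 < (minpoly ℚ α).natDegree)
    (hM : M ∈ formAbsAut (minpolyForm α)) : ∃ β, IsConjRoot ℚ α β ∧ MoebiusMaps M α β := by
  have hint := isIntegral_of_natDegree_pos (zero_lt_one.trans hα)
  have hzero (x y : K) (h : aeval ![x, y] (minpolyForm α) = 0) :
      aeval ![x, y] (formSubst (minpolyForm α) M) = 0 := by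
    rcases hM with hM | hM <;> simp [hM, h]
  have hroot : aeval ![(M 0 0 : K) * α + M 0 1, (M 1 0 : K) * α + M 1 1] (minpolyForm α) = 0 := by
    have h := aeval_formSubst (minpolyForm α) M α 1
    have h₁ : aeval ![α, 1] (minpolyForm α) = 0 := by
      simp [minpolyForm, aeval_homogenize le_rfl]
    rw [hzero α 1 h₁] at h
    simpa using h.symm
  have hden : (M 1 0 : K) * α + M 1 1 ≠ 0 := by
    intro hden
    rw [hden, minpolyForm, aeval_homogenize_right_zero, (minpoly.monic hint).coeff_natDegree,
      Rat.cast_one, one_mul, pow_eq_zero_iff (zero_lt_one.trans hα).ne'] at hroot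
    obtain ⟨h₀₀, h₀₁⟩ := (ratCast_mul_add_ratCast_eq_zero_iff hα).mp hroot
    obtain ⟨h₁₀, h₁₁⟩ := (ratCast_mul_add_ratCast_eq_zero_iff hα).mp hden
    have hM₀ : M = (0 : ℚ) • 1 := by
      ext i j
      fin_cases i <;> fin_cases j <;> simp [h₀₀, h₀₁, h₁₀, h₁₁]
    have := eq_one_or_eq_neg_one_of_smul_one_mem_formAbsAut (isHomogeneous_minpolyForm α)
      (minpolyForm_ne_zero hint) (zero_lt_one.trans hα).ne' (hM₀ ▸ hM)
    norm_num at this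
  rw [minpolyForm, aeval_homogenize le_rfl _ hden] at hroot
  refine ⟨_, isConjRoot_of_aeval_eq_zero hint ((mul_eq_zero.mp hroot).resolve_left ?_), hden,
    (div_mul_cancel₀ _ hden).symm⟩
  exact pow_ne_zero _ hden

theorem eq_or_eq_neg_of_moebiusMaps (hα : 2 < (minpoly ℚ α).natDegree)
    (hM : M ∈ formAbsAut (minpolyForm α)) (hN : N ∈ formAbsAut (minpolyForm α))
    (hMβ : MoebiusMaps M α β) (hNβ : MoebiusMaps N α β) : M = N ∨ M = -N := by
  have hint := isIntegral_of_natDegree_pos (zero_lt_two.trans hα)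
  obtain ⟨β', hβ', hNβ'⟩ := exists_isConjRoot_moebiusMaps (one_lt_two.trans hα) hN
  obtain rfl := hNβ'.right_unique hNβ
  have hdet : N.det ≠ 0 :=
    hNβ.det_ne_zero (ne_ratCast_of_one_lt_natDegree (hβ' ▸ one_lt_two.trans hα))
  have hinv : N⁻¹ * N = 1 := Matrix.nonsing_inv_mul N hdet.isUnit
  have hinv' : N * N⁻¹ = 1 := Matrix.mul_nonsing_inv N hdet.isUnit
  have hfix : N⁻¹ * M = (N⁻¹ * M) 0 0 • 1 := ((hNβ.of_mul_eq_one hinv).mul hMβ).eq_smul_one hα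
  have hmem : N⁻¹ * M ∈ formAbsAut (minpolyForm α) :=
    mul_mem (mem_formAbsAut_of_mul_eq_one hinv' hN) hM
  have hMN : M = N * (N⁻¹ * M) := by rw [← mul_assoc, hinv', one_mul]
  rw [hfix] at hmem hMN
  rcases eq_one_or_eq_neg_one_of_smul_one_mem_formAbsAut (isHomogeneous_minpolyForm α)
    (minpolyForm_ne_zero hint) (zero_lt_two.trans hα).ne' hmem with hc | hc
  · exact Or.inl (by simpa [hc] using hMN)
  · exact Or.inr (by simpa [hc] using hMN)

theorem neg_one_notMem_formAut (hα : Odd (minpoly ℚ α).natDegree) :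
    -1 ∉ formAut (minpolyForm α) := by
  intro h
  have h : formSubst (minpolyForm α) (-1) = minpolyForm α := h
  rw [← neg_one_smul ℚ 1, formSubst_smul_one (isHomogeneous_minpolyForm α), hα.neg_one_pow, map_neg,
    map_one, neg_one_mul, neg_eq_self] at h
  exact minpolyForm_ne_zero (isIntegral_of_natDegree_pos hα.pos) h

/-- The matrices in `A` realise, at `α`, every Möbius transformation coming from `Aut |F|`, where
`F` is the form attached to `α`. -/
def RealizesFormAbsAut (A : Submonoid (Matrix (Fin 2) (Fin 2) ℚ)) (α : K) : Prop :=
  ∀ M ∈ formAbsAut (minpolyForm α), ∃ N ∈ A, ∃ β, MoebiusMaps M α β ∧ MoebiusMaps N α β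

namespace RealizesFormAbsAut

variable {A : Submonoid (Matrix (Fin 2) (Fin 2) ℚ)}

theorem mem_or_neg_mem (h : RealizesFormAbsAut A α) (hα : 2 < (minpoly ℚ α).natDegree)
    (hA : A ≤ formAbsAut (minpolyForm α)) (hM : M ∈ formAbsAut (minpolyForm α)) :
    M ∈ A ∨ -M ∈ A := by
  obtain ⟨N, hN, β, hMβ, hNβ⟩ := h M hM
  refine (eq_or_eq_neg_of_moebiusMaps hα hM (hA hN) hMβ hNβ).imp ?_ ?_ <;> rintro rfl <;> simpa

theorem formAbsAut_eq (h : RealizesFormAbsAut A α) (hα : 2 < (minpoly ℚ α).natDegree)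
    (hA : A ≤ formAbsAut (minpolyForm α)) (hneg : -1 ∈ A) : formAbsAut (minpolyForm α) = A := by
  refine le_antisymm (fun M hM ↦ (h.mem_or_neg_mem hα hA hM).elim id fun hM' ↦ ?_) hA
  simpa using mul_mem hneg hM'

theorem formAut_eq_of_neg_one_mem (h : RealizesFormAbsAut A α)
    (hα : 2 < (minpoly ℚ α).natDegree) (hA : A ≤ formAut (minpolyForm α)) (hneg : -1 ∈ A) :
    formAut (minpolyForm α) = A := by
  refine le_antisymm ((formAut_le_formAbsAut _).trans ?_) hA
  exact (h.formAbsAut_eq hα (hA.trans (formAut_le_formAbsAut _)) hneg).le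

theorem formAut_eq_of_odd (h : RealizesFormAbsAut A α) (hα : 2 < (minpoly ℚ α).natDegree)
    (hA : A ≤ formAut (minpolyForm α)) (hodd : Odd (minpoly ℚ α).natDegree) :
    formAut (minpolyForm α) = A := by
  refine le_antisymm (fun M hM ↦ ?_) hA
  refine (h.mem_or_neg_mem hα (hA.trans (formAut_le_formAbsAut _))
    (formAut_le_formAbsAut _ hM)).resolve_right fun hM' ↦ neg_one_notMem_formAut hodd ?_
  have hM₁ : formSubst (minpolyForm α) M = minpolyForm α := hM
  have hM₂ : formSubst (minpolyForm α) (M * -1) = minpolyForm α := by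
    rw [mul_neg, mul_one]
    exact hA hM'
  rwa [formSubst_mul, hM₁] at hM₂

theorem mono {B : Submonoid (Matrix (Fin 2) (Fin 2) ℚ)} (h : RealizesFormAbsAut A α)
    (hAB : A ≤ B) : RealizesFormAbsAut B α := fun M hM ↦
  let ⟨N, hN, hβ⟩ := h M hM
  ⟨N, hAB hN, hβ⟩

end RealizesFormAbsAut

end Forms

section MatrixGroups

variable {M : Matrix (Fin 2) (Fin 2) ℚ} {S T : Set (Matrix (Fin 2) (Fin 2) ℚ)}
  {F : MvPolynomial (Fin 2) ℚ}

theorem coe_mem_glMatrices {G : Subgroup (GL (Fin 2) ℚ)} {g : GL (Fin 2) ℚ} :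
    (g : Matrix (Fin 2) (Fin 2) ℚ) ∈ glMatrices G ↔ g ∈ G :=
  ⟨fun ⟨_, hh, hg⟩ ↦ Units.val_injective hg ▸ hh, fun hg ↦ ⟨g, hg, rfl⟩⟩

theorem mem_glMatrices_glSpan (hM : M ∈ S) (hdet : M.det ≠ 0) : M ∈ glMatrices (glSpan S) :=
  ⟨GeneralLinearGroup.mkOfDetNeZero M hdet, Subgroup.subset_closure hM, rfl⟩

theorem glMatrices_glSpan_le {A : Submonoid (Matrix (Fin 2) (Fin 2) ℚ)}
    (hA : ∀ {M N}, M * N = 1 → M ∈ A → N ∈ A) (hS : S ⊆ A) : glMatrices (glSpan S) ≤ A := by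
  rintro _ ⟨g, hg, rfl⟩
  change (g : Matrix (Fin 2) (Fin 2) ℚ) ∈ A
  induction hg using Subgroup.closure_induction with
  | mem g hg => exact hS hg
  | one => exact one_mem A
  | mul g h _ _ hg hh => exact mul_mem hg hh
  | inv g _ hg => exact hA (by simp) hg

theorem glMatrices_glSpan_le_formAut (hS : S ⊆ formAut F) : glMatrices (glSpan S) ≤ formAut F :=
  glMatrices_glSpan_le mem_formAut_of_mul_eq_one hS

theorem glMatrices_glSpan_le_formAbsAut (hS : S ⊆ formAbsAut F) :
    glMatrices (glSpan S) ≤ formAbsAut F :=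
  glMatrices_glSpan_le mem_formAbsAut_of_mul_eq_one hS

theorem glMatrices_glSpan_mono (h : S ⊆ T) : glMatrices (glSpan S) ≤ glMatrices (glSpan T) :=
  Submonoid.monotone_map (Subgroup.closure_mono fun _ hg ↦ h hg)

theorem isGLConj_glMatrices (G : Subgroup (GL (Fin 2) ℚ)) : IsGLConj (glMatrices G) G :=
  ⟨1, by
    congr 1
    ext g
    simp⟩

theorem isGLConj_glSpan {P Q : Matrix (Fin 2) (Fin 2) ℚ} (hPQ : P * Q = 1)
    (hS : ∀ M ∈ S, P * M * Q ∈ glMatrices (glSpan T))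
    (hT : ∀ M ∈ T, Q * M * P ∈ glMatrices (glSpan S)) :
    IsGLConj (glMatrices (glSpan T)) (glSpan S) := by
  let R : GL (Fin 2) ℚ := ⟨P, Q, hPQ, mul_eq_one_comm.mp hPQ⟩
  refine ⟨R, congrArg glMatrices (le_antisymm ?_ ?_)⟩
  · refine (Subgroup.closure_le _).mpr fun g hg ↦ ⟨R⁻¹ * g * R, ?_, by simp; group⟩
    exact coe_mem_glMatrices.mp (hT _ hg)
  · refine Subgroup.map_le_iff_le_comap.mpr ((Subgroup.closure_le _).mpr fun g hg ↦ ?_)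
    exact (coe_mem_glMatrices (g := R * g * R⁻¹)).mp (hS _ hg)

theorem IsGLConj.nonempty_mulEquiv {A : Submonoid (Matrix (Fin 2) (Fin 2) ℚ)}
    {G : Subgroup (GL (Fin 2) ℚ)} (h : IsGLConj A G) : Nonempty (A ≃* G) := by
  obtain ⟨P, rfl⟩ := h
  exact ⟨((G.equivMapOfInjective _ (MulAut.conj P).injective).trans
    (Submonoid.equivMapOfInjective _ _ Units.val_injective)).symm⟩

theorem neg_one_fin_two : !![-1, 0; 0, -1] = (-1 : Matrix (Fin 2) (Fin 2) ℚ) := by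
  simp [one_fin_two]

theorem glMatrices_groupC1 : glMatrices groupC1 = ⊥ := by
  refine eq_bot_iff.mpr (glMatrices_glSpan_le (fun h hM ↦ ?_) ?_)
  · rw [Submonoid.mem_bot] at hM ⊢
    rwa [hM, one_mul] at h
  · simp [one_fin_two]

theorem neg_one_mem_glMatrices_groupC2 : -1 ∈ glMatrices groupC2 :=
  mem_glMatrices_glSpan neg_one_fin_two.symm (by simp [det_neg])

theorem coe_glMatrices_groupC2 :
    (glMatrices groupC2 : Set (Matrix (Fin 2) (Fin 2) ℚ)) = {1, -1} := by
  refine Set.Subset.antisymm ?_ (Set.pair_subset (one_mem _) neg_one_mem_glMatrices_groupC2)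
  let A : Submonoid (Matrix (Fin 2) (Fin 2) ℚ) :=
    { carrier := {1, -1}
      one_mem' := Or.inl rfl
      mul_mem' := by rintro M N (rfl | rfl) (rfl | rfl) <;> simp }
  refine glMatrices_glSpan_le (A := A) ?_ (Set.singleton_subset_iff.mpr (Or.inr neg_one_fin_two))
  rintro M N h (rfl | rfl)
  · exact Or.inl (by simpa using h)
  · exact Or.inr (by simpa [neg_eq_iff_eq_neg] using h)

theorem neg_one_mem_glMatrices_diagonal :
    -1 ∈ glMatrices (glSpan {!![-1, 0; 0, 1], !![1, 0; 0, -1]}) := by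
  have := mul_mem (S := Submonoid (Matrix (Fin 2) (Fin 2) ℚ))
    (mem_glMatrices_glSpan (S := {!![-1, 0; 0, 1], !![1, 0; 0, -1]}) (Or.inl rfl) (by simp))
    (mem_glMatrices_glSpan (Or.inr rfl) (by simp))
  simpa [neg_one_fin_two] using this

theorem isGLConj_diagonal_groupD2 :
    IsGLConj (glMatrices (glSpan {!![-1, 0; 0, 1], !![1, 0; 0, -1]})) groupD2 := by
  have hPQ : !![1, 1; 1, -1] * !![1 / 2, 1 / 2; 1 / 2, -1 / 2] =
      (1 : Matrix (Fin 2) (Fin 2) ℚ) := by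
    rw [one_fin_two]
    norm_num
  refine isGLConj_glSpan hPQ ?_ ?_
  · rintro M (rfl | rfl)
    · exact mem_glMatrices_glSpan (by norm_num) (by norm_num)
    · convert neg_one_mem_glMatrices_diagonal using 1
      rw [one_fin_two]
      norm_num
  · rintro M (rfl | rfl)
    · have := mul_mem (S := Submonoid (Matrix (Fin 2) (Fin 2) ℚ))
        (mem_glMatrices_glSpan (S := {!![0, 1; 1, 0], !![-1, 0; 0, -1]}) (Or.inl rfl) (by simp))
        (mem_glMatrices_glSpan (Or.inr rfl) (by simp))
      convert this using 1
      norm_num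
    · exact mem_glMatrices_glSpan (by norm_num) (by norm_num)

theorem isGLConj_groupC3 : IsGLConj (glMatrices (glSpan {!![-1, 1; -1, 0]})) groupC3 := by
  have hPQ : !![1, 1; 0, 1] * !![1, -1; 0, 1] = (1 : Matrix (Fin 2) (Fin 2) ℚ) := by
    simp [one_fin_two]
  refine isGLConj_glSpan hPQ ?_ ?_ <;> rintro M rfl <;>
    exact mem_glMatrices_glSpan (by norm_num) (by norm_num)

theorem isGLConj_groupC4 : IsGLConj (glMatrices (glSpan {!![1, 2; -1, -1]})) groupC4 := by
  have hPQ : !![1, -1; 0, 1] * !![1, 1; 0, 1] = (1 : Matrix (Fin 2) (Fin 2) ℚ) := by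
    simp [one_fin_two]
  refine isGLConj_glSpan hPQ ?_ ?_ <;> rintro M rfl <;>
    exact mem_glMatrices_glSpan (by norm_num) (by norm_num)

theorem isGLConj_groupC6 :
    IsGLConj (glMatrices (glSpan {!![-1, 1; -1, 0], !![-1, 0; 0, -1]})) groupC6 := by
  have hPQ : !![1, 1; 0, 1] * !![1, -1; 0, 1] = (1 : Matrix (Fin 2) (Fin 2) ℚ) := by
    simp [one_fin_two]
  refine isGLConj_glSpan hPQ ?_ ?_
  · rintro M rfl
    have := mul_mem (S := Submonoid (Matrix (Fin 2) (Fin 2) ℚ))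
      (mem_glMatrices_glSpan (S := {!![-1, 1; -1, 0], !![-1, 0; 0, -1]}) (Or.inl rfl) (by simp))
      (mem_glMatrices_glSpan (Or.inr rfl) (by simp))
    simpa using this
  · have hgen : !![0, -1; 1, 1] ∈ glMatrices (glSpan {!![0, -1; 1, 1]}) :=
      mem_glMatrices_glSpan rfl (by simp)
    rintro M (rfl | rfl)
    · simpa [pow_succ] using pow_mem hgen 4
    · simpa [pow_succ] using pow_mem hgen 3

end MatrixGroups

section AbelianGalois

variable {E : Type*} [Field E] [CharZero E] {α β : E} {M : Matrix (Fin 2) (Fin 2) ℚ}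

theorem MoebiusMaps.exists_algEquiv [IsAbelianGalois ℚ E] (h : MoebiusMaps M α β)
    (hβ : IsConjRoot ℚ α β) :
    ∃ τ : E ≃ₐ[ℚ] E, τ α = β ∧ ∀ γ, IsConjRoot ℚ α γ → MoebiusMaps M γ (τ γ) := by
  obtain ⟨τ, hτ⟩ := hβ.symm.exists_algEquiv
  refine ⟨τ, hτ, fun γ hγ ↦ ?_⟩
  obtain ⟨σ, rfl⟩ := hγ.symm.exists_algEquiv
  have hcomm : τ (σ α) = σ (τ α) := DFunLike.congr_fun (mul_comm' τ σ) α
  rw [hcomm, hτ]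
  exact h.map (σ : E →+* E)

theorem eq_or_eq_neg_of_algEquiv_eq_ratCast_mul [FiniteDimensional ℚ E] (τ : E ≃ₐ[ℚ] E)
    (hα : α ≠ 0) {c : ℚ} (h : τ α = c * α) : τ α = α ∨ τ α = -α := by
  have hc : c ^ Module.finrank ℚ E = 1 := by
    have hnorm := Algebra.norm_eq_of_algEquiv τ α
    rw [h, map_mul, ← eq_ratCast (algebraMap ℚ E), Algebra.norm_algebraMap] at hnorm
    exact mul_right_cancel₀ (Algebra.norm_ne_zero_iff.mpr hα) (hnorm.trans (one_mul _).symm)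
  have habs : |c| ^ Module.finrank ℚ E = 1 := by rw [← abs_pow, hc, abs_one]
  rw [h]
  refine (eq_or_eq_neg_of_abs_eq ((pow_eq_one_iff_of_nonneg (abs_nonneg c)
    Module.finrank_pos.ne').mp habs)).imp ?_ ?_ <;> rintro rfl <;> simp

theorem MoebiusMaps.diagonal_or_antidiagonal (hα : 2 < (minpoly ℚ α).natDegree)
    (h : MoebiusMaps M α β) (hneg : MoebiusMaps M (-α) (-β)) (hβ : ∀ q : ℚ, β ≠ q) :
    M 0 1 = 0 ∧ M 1 0 = 0 ∨ M 0 0 = 0 ∧ M 1 1 = 0 := by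
  have hdet := h.det_ne_zero hβ
  rw [Matrix.det_fin_two] at hdet
  have hc : ![M 0 1 * M 1 1, 0, -(M 0 0 * M 1 0)] = 0 := by
    refine eq_zero_of_sum_mul_pow_eq_zero (α := α) hα ?_
    have h₁ := h.2
    have h₂ := hneg.2
    simp only [Fin.sum_univ_three, Matrix.cons_val, Rat.cast_neg, Rat.cast_mul, Rat.cast_zero,
      Fin.val_zero, Fin.val_one, Fin.val_two, pow_zero, pow_one]
    linear_combination (M 1 1 - M 1 0 * α : E) / 2 * h₁ + (M 1 0 * α + M 1 1 : E) / 2 * h₂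
  have h0 := congrFun hc 0
  have h2 := congrFun hc 2
  simp only [Matrix.cons_val, Pi.zero_apply, neg_eq_zero, mul_eq_zero] at h0 h2
  grind

theorem even_natDegree_of_isConjRoot_neg (hα : 1 < (minpoly ℚ α).natDegree)
    (hneg : IsConjRoot ℚ α (-α)) : Even (minpoly ℚ α).natDegree := by
  by_contra hodd
  have h := congrArg (Polynomial.eval 0) (minpoly.neg (A := ℚ) α)
  rw [← hneg, Nat.not_even_iff_odd.mp hodd |>.neg_one_pow] at h
  simp only [neg_mul, one_mul, Polynomial.eval_neg, Polynomial.eval_comp, Polynomial.eval_X,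
    neg_zero, self_eq_neg, ← Polynomial.coeff_zero_eq_eval_zero] at h
  rw [minpoly.coeff_zero_eq_zero (isIntegral_of_natDegree_pos (zero_lt_one.trans hα))] at h
  simp [h] at hα

theorem diagonal_mem_formAut (hα : 1 < (minpoly ℚ α).natDegree) (hneg : IsConjRoot ℚ α (-α)) :
    !![-1, 0; 0, 1] ∈ formAut (minpolyForm α) := by
  have heven : ((minpoly ℚ α).comp (-Polynomial.X)) = minpoly ℚ α := by
    have h := minpoly.neg (A := ℚ) α
    rwa [(even_natDegree_of_isConjRoot_neg hα hneg).neg_one_pow, one_mul, ← hneg, eq_comm] at h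
  refine form_ext_of_aeval fun x y hy ↦ ?_
  rw [aeval_formSubst]
  simp only [minpolyForm, Matrix.of_apply, Matrix.cons_val, map_neg, map_one, map_zero, neg_mul,
    one_mul, zero_mul, add_zero, zero_add]
  rw [aeval_homogenize le_rfl _ hy, aeval_homogenize le_rfl _ hy, neg_div]
  have h := congrArg (Polynomial.aeval (x / y)) heven
  simp only [Polynomial.aeval_comp, map_neg, Polynomial.aeval_X] at h
  rw [h]

theorem glMatrices_diagonal_le_formAut (hα : 1 < (minpoly ℚ α).natDegree)
    (hneg : IsConjRoot ℚ α (-α)) :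
    glMatrices (glSpan {!![-1, 0; 0, 1], !![1, 0; 0, -1]}) ≤ formAut (minpolyForm α) := by
  have hmem := diagonal_mem_formAut hα hneg
  refine glMatrices_glSpan_le_formAut (Set.pair_subset hmem ?_)
  have hneg_one := neg_one_mem_formAut (isHomogeneous_minpolyForm α)
    (even_natDegree_of_isConjRoot_neg hα hneg)
  simpa using mul_mem hneg_one hmem

section

open Polynomial

/-- The numerator of `M ∘ q - q ∘ M`, where `q(x) = ε (x² - 2)` and `M` acts as a Möbius
transformation; it vanishes when the two maps commute. -/
noncomputable def commutatorNumerator (M : Matrix (Fin 2) (Fin 2) ℚ) (ε : ℚ) : ℚ[X] :=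
  (C (M 0 0) * (C ε * (X ^ 2 - 2)) + C (M 0 1)) * (C (M 1 0) * X + C (M 1 1)) ^ 2 -
    C ε * ((C (M 0 0) * X + C (M 0 1)) ^ 2 - 2 * (C (M 1 0) * X + C (M 1 1)) ^ 2) *
      (C (M 1 0) * (C ε * (X ^ 2 - 2)) + C (M 1 1))

theorem eq_smul_one_of_commutatorNumerator_eq_zero {ε : ℚ} (hε : ε ≠ 0) (hdet : M.det ≠ 0)
    (h : commutatorNumerator M ε = 0) : M = M 0 0 • (1 : Matrix (Fin 2) (Fin 2) ℚ) := by
  have heval (x : ℚ) := congrArg (eval x) h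
  have hderiv (x : ℚ) := congrArg (fun p ↦ eval x (derivative p)) h
  simp only [commutatorNumerator, eval_sub, eval_add, eval_mul, eval_pow, eval_C, eval_X,
    eval_ofNat, eval_zero, eval_one, derivative_sub, derivative_add, derivative_mul, derivative_C,
    derivative_X, derivative_pow, derivative_ofNat, derivative_zero] at heval hderiv
  rw [Matrix.det_fin_two] at hdet
  suffices M 1 0 = 0 ∧ M 0 1 = 0 ∧ M 0 0 = M 1 1 by
    ext i j
    fin_cases i <;> fin_cases j <;> simp [this]
  generalize M 0 0 = s, M 0 1 = u, M 1 0 = t, M 1 1 = v at *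
  -- The pole `z` of `M` would be a fixed point of `q`, and the derivative at `z` shows `z = 0`.
  have ht : t = 0 := by
    by_contra ht
    obtain ⟨z, rfl⟩ : ∃ z, v = -(t * z) := ⟨-v / t, by field_simp⟩
    have hsz : s * z + u ≠ 0 := fun h ↦ hdet (by linear_combination -t * h)
    have hz₁ : ε * (z ^ 2 - 2) - z = 0 := by
      refine (mul_eq_zero.mp ?_).resolve_left (mul_ne_zero (mul_ne_zero hε (pow_ne_zero 2 hsz)) ht)
      linear_combination -heval z
    have hz₂ : z = 0 := by
      refine (mul_eq_zero.mp ?_).resolve_left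
        (mul_ne_zero (mul_ne_zero (pow_ne_zero 2 hε) (pow_ne_zero 2 hsz)) ht)
      linear_combination -(1 / 2 : ℚ) * hderiv z - ε * s * t * (s * z + u) * hz₁
    simp [hz₂, hε] at hz₁
  subst ht
  rw [mul_zero, sub_zero] at hdet
  have hu : u = 0 := by
    refine (mul_eq_zero.mp ?_).resolve_left (mul_ne_zero hε hdet)
    linear_combination (1 / 4 : ℚ) * (heval (-1) - heval 1)
  subst hu
  refine ⟨rfl, rfl, sub_eq_zero.mp ((mul_eq_zero.mp ?_).resolve_left (mul_ne_zero hε hdet))⟩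
  linear_combination (-1 : ℚ) * (heval 1 - heval 0)

theorem MoebiusMaps.eq_of_sq_sub_two (hα : 4 < (minpoly ℚ α).natDegree) {ε : ℚ} (hε : ε ≠ 0)
    (h : MoebiusMaps M α β) (hsq : MoebiusMaps M (ε * (α ^ 2 - 2)) (ε * (β ^ 2 - 2)))
    (hβ : ∀ q : ℚ, β ≠ q) : β = α := by
  have hQ : commutatorNumerator M ε = 0 := by
    by_contra hQ
    refine (hα.trans_le (natDegree_le_natDegree (minpoly.degree_le_of_ne_zero ℚ α hQ ?_))).not_ge
      (by unfold commutatorNumerator; compute_degree)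
    simp only [commutatorNumerator, map_sub, map_add, map_mul, map_pow, aeval_C, aeval_X,
      map_ofNat, eq_ratCast]
    linear_combination (M 1 0 * α + M 1 1 : E) ^ 2 * hsq.2 -
      ε * (M 1 0 * (ε * (α ^ 2 - 2)) + M 1 1) *
        (M 0 0 * α + M 0 1 + β * (M 1 0 * α + M 1 1)) * h.2
  have hM := eq_smul_one_of_commutatorNumerator_eq_zero hε (h.det_ne_zero hβ) hQ
  rw [hM] at h
  have hs : (M 0 0 : E) ≠ 0 := by simpa using h.1
  simpa [hs, mul_comm] using h.2.symm

end

theorem RealizesFormAbsAut.of_sq_sub_two [IsAbelianGalois ℚ E]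
    (hα : 4 < (minpoly ℚ α).natDegree) {ε : ℚ} (hε : ε ≠ 0)
    (hsq : IsConjRoot ℚ α (ε * (α ^ 2 - 2))) : RealizesFormAbsAut ⊥ α := by
  intro M hM
  have hα₁ : 1 < (minpoly ℚ α).natDegree := by lia
  obtain ⟨β, hβ, h⟩ := exists_isConjRoot_moebiusMaps hα₁ hM
  obtain ⟨τ, rfl, hτ⟩ := h.exists_algEquiv hβ
  have hτsq := hτ _ hsq
  simp only [map_mul, map_sub, map_pow, map_ratCast, map_ofNat] at hτsq
  rw [h.eq_of_sq_sub_two hα hε hτsq (ne_ratCast_of_one_lt_natDegree (hβ ▸ hα₁))] at h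
  exact ⟨1, one_mem _, α, h, .one α⟩

theorem RealizesFormAbsAut.diagonal [IsAbelianGalois ℚ E] [FiniteDimensional ℚ E]
    (hα : 2 < (minpoly ℚ α).natDegree) (hneg : IsConjRoot ℚ α (-α))
    (hprod : ∀ (τ : E ≃ₐ[ℚ] E) (r : ℚ), ∃ γ, IsConjRoot ℚ α γ ∧ γ * τ γ ≠ r) :
    RealizesFormAbsAut (glMatrices (glSpan {!![-1, 0; 0, 1], !![1, 0; 0, -1]})) α := by
  intro M hM
  have hα₁ : 1 < (minpoly ℚ α).natDegree := by lia
  obtain ⟨β, hβ, h⟩ := exists_isConjRoot_moebiusMaps hα₁ hM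
  obtain ⟨τ, rfl, hτ⟩ := h.exists_algEquiv hβ
  have hτneg := hτ _ hneg
  rw [map_neg] at hτneg
  rcases h.diagonal_or_antidiagonal hα hτneg (ne_ratCast_of_one_lt_natDegree (hβ ▸ hα₁)) with
    ⟨hu, ht⟩ | ⟨hs, hv⟩
  · have hv : (M 1 1 : E) ≠ 0 := by simpa [ht] using h.1
    have hτα : τ α = (M 0 0 / M 1 1 : ℚ) * α := by
      rw [Rat.cast_div, div_mul_eq_mul_div, eq_div_iff hv]
      simpa [hu, ht] using h.2.symm
    have hα₀ : α ≠ 0 := by simpa using ne_ratCast_of_one_lt_natDegree hα₁ 0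
    rcases eq_or_eq_neg_of_algEquiv_eq_ratCast_mul τ hα₀ hτα with hτα | hτα <;> rw [hτα] at h
    · exact ⟨1, one_mem _, α, h, .one α⟩
    · exact ⟨_, mem_glMatrices_glSpan (Or.inl rfl) (by simp), -α, h, by simp [MoebiusMaps]⟩
  · obtain ⟨γ, hγ, hne⟩ := hprod τ (M 0 1 / M 1 0)
    obtain ⟨hden, hnum⟩ := hτ γ hγ
    simp only [hs, hv, Rat.cast_zero, zero_mul, zero_add, add_zero] at hden hnum
    refine absurd ?_ hne
    rw [Rat.cast_div, eq_div_iff (left_ne_zero_of_mul hden), hnum]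
    ring

end AbelianGalois

section Cyclotomic

open Polynomial in
theorem minpoly_aeval_eq_minpoly_mk {F K : Type*} [Field F] [Field K] [Algebra F K] {x : K}
    (hx : IsIntegral F x) (p : F[X]) :
    minpoly F (aeval x p) = minpoly F (AdjoinRoot.mk (minpoly F x) p) := by
  have : Fact (Irreducible (minpoly F x)) := ⟨minpoly.irreducible hx⟩
  have h := minpoly.algHom_eq (AdjoinRoot.liftAlgHom _ (Algebra.ofId F K) x (minpoly.aeval F x))
    (RingHom.injective _) (AdjoinRoot.mk (minpoly F x) p)
  rw [← h]
  exact congrArg (minpoly F) (AdjoinRoot.lift_mk (minpoly.aeval F x) p).symm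

open Polynomial in
theorem minpoly_aeval_congr {F K L : Type*} [Field F] [Field K] [Field L] [Algebra F K]
    [Algebra F L] {x : K} {y : L} (hx : IsIntegral F x) (h : minpoly F x = minpoly F y)
    (p : F[X]) : minpoly F (aeval x p) = minpoly F (aeval y p) := by
  have hy : IsIntegral F y := by
    by_contra hy
    exact minpoly.ne_zero hx (h.trans (minpoly.eq_zero hy))
  rw [minpoly_aeval_eq_minpoly_mk hx, minpoly_aeval_eq_minpoly_mk hy, h]

theorem inv_eq_pow_sub_one_of_isPrimitiveRoot {K : Type*} [Field K] {N : ℕ} [NeZero N] {ζ : K}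
    (hζ : IsPrimitiveRoot ζ N) : ζ⁻¹ = ζ ^ (N - 1) :=
  inv_eq_of_mul_eq_one_right (by rw [mul_pow_sub_one (NeZero.ne N), hζ.pow_eq_one])

variable {K L : Type*} [Field K] [CharZero K] [Field L] [CharZero L] {N : ℕ} {ζ : K} {η : L}

theorem minpoly_add_inv_eq [NeZero N] (hζ : IsPrimitiveRoot ζ N) (hη : IsPrimitiveRoot η N) :
    minpoly ℚ (ζ + ζ⁻¹) = minpoly ℚ (η + η⁻¹) := by
  have h := minpoly_aeval_congr (hζ.isIntegral (NeZero.pos N)).tower_top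
    ((Polynomial.cyclotomic_eq_minpoly_rat hζ (NeZero.pos N)).symm.trans
      (Polynomial.cyclotomic_eq_minpoly_rat hη (NeZero.pos N))) (.X + .X ^ (N - 1))
  simpa [inv_eq_pow_sub_one_of_isPrimitiveRoot hζ, inv_eq_pow_sub_one_of_isPrimitiveRoot hη] using h

theorem isConjRoot_add_inv_pow [NeZero N] (hζ : IsPrimitiveRoot ζ N) {k : ℕ} (hk : k.Coprime N) :
    IsConjRoot ℚ (ζ + ζ⁻¹) (ζ ^ k + (ζ ^ k)⁻¹) :=
  minpoly_add_inv_eq hζ (hζ.pow_of_coprime k hk)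

theorem pow_eq_neg_one_of_isPrimitiveRoot_two_mul {K : Type*} [Field K] {ζ : K} {w : ℕ}
    [NeZero w] (hζ : IsPrimitiveRoot ζ (2 * w)) : ζ ^ w = -1 :=
  (hζ.pow (Nat.pos_of_neZero _) (mul_comm 2 w)).eq_neg_one_of_two_right

theorem sq_pow_eq_neg_one_of_isPrimitiveRoot_four_mul {K : Type*} [Field K] {ζ : K} {w : ℕ}
    [NeZero w] (hζ : IsPrimitiveRoot ζ (4 * w)) : (ζ ^ w) ^ 2 = -1 := by
  rw [← pow_mul, mul_comm]
  exact pow_eq_neg_one_of_isPrimitiveRoot_two_mul (by rwa [← mul_assoc])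

theorem coprime_four_mul_of_odd {k w : ℕ} (hk : Odd k) (h : k.Coprime w) : k.Coprime (4 * w) :=
  Nat.Coprime.mul_right (hk.coprime_two_right.pow_right 2) h

theorem isConjRoot_neg_add_inv {w : ℕ} [NeZero w] (hζ : IsPrimitiveRoot ζ (4 * w)) :
    IsConjRoot ℚ (ζ + ζ⁻¹) (-(ζ + ζ⁻¹)) := by
  have h := isConjRoot_add_inv_pow hζ (k := 1 + 2 * w)
    (coprime_four_mul_of_odd (odd_one.add_even (even_two_mul w)) (by simp))
  rwa [pow_add, mul_comm 2, pow_mul, sq_pow_eq_neg_one_of_isPrimitiveRoot_four_mul hζ, pow_one,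
    mul_neg_one, inv_neg, ← neg_add] at h

theorem exists_isConjRoot_sq_sub_two [NeZero N] (hN : ¬4 ∣ N) (hζ : IsPrimitiveRoot ζ N) :
    ∃ ε : ℚ, ε ≠ 0 ∧ IsConjRoot ℚ (ζ + ζ⁻¹) (ε * ((ζ + ζ⁻¹) ^ 2 - 2)) := by
  have hζ₀ := hζ.ne_zero (NeZero.ne N)
  have hsq : (ζ + ζ⁻¹) ^ 2 - 2 = ζ ^ 2 + (ζ ^ 2)⁻¹ := by
    field_simp
    ring
  rw [hsq]
  rcases N.even_or_odd' with ⟨m, rfl | rfl⟩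
  · have : NeZero m := ⟨by rintro rfl; simp at hN⟩
    have hm : Odd m := by grind
    have hk : (2 + m).Coprime (2 * m) := by
      refine Nat.Coprime.mul_right (Odd.coprime_two_right ?_) ?_
      · exact even_two.add_odd hm
      · simpa using hm.coprime_two_left
    refine ⟨-1, by simp, ?_⟩
    have h := isConjRoot_add_inv_pow hζ hk
    rw [pow_add, pow_eq_neg_one_of_isPrimitiveRoot_two_mul hζ, mul_neg_one, inv_neg] at h
    simpa [add_comm] using h
  · refine ⟨1, one_ne_zero, ?_⟩
    simpa using isConjRoot_add_inv_pow hζ (k := 2) (by simp)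

theorem exists_isConjRoot_sq_eq_of_even {w : ℕ} [NeZero w] (hw : Even w)
    (hζ : IsPrimitiveRoot ζ (4 * w)) :
    ∃ γ, IsConjRoot ℚ (ζ + ζ⁻¹) γ ∧ γ ^ 2 = 4 - (ζ + ζ⁻¹) ^ 2 := by
  have hζ₀ := hζ.ne_zero (NeZero.ne _)
  have hi₀ := pow_ne_zero w hζ₀
  have hi₂ := sq_pow_eq_neg_one_of_isPrimitiveRoot_four_mul hζ
  refine ⟨_, isConjRoot_add_inv_pow hζ (k := 1 + w)
    (coprime_four_mul_of_odd (odd_one.add_even hw) (by simp)), ?_⟩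
  rw [pow_add]
  generalize ζ ^ w = i at *
  field_simp
  linear_combination (ζ ^ 4 * i ^ 2 + 1) * hi₂

theorem exists_isConjRoot_sq_eq_of_odd {w : ℕ} (hw : Odd w) (hζ : IsPrimitiveRoot ζ (4 * w)) :
    ∃ γ, IsConjRoot ℚ (ζ + ζ⁻¹) γ ∧ γ ^ 2 = (ζ + ζ⁻¹) ^ 2 * (4 - (ζ + ζ⁻¹) ^ 2) := by
  have : NeZero w := ⟨hw.pos.ne'⟩
  have hζ₀ := hζ.ne_zero (NeZero.ne _)
  have hi₀ := pow_ne_zero w hζ₀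
  have hi₂ := sq_pow_eq_neg_one_of_isPrimitiveRoot_four_mul hζ
  refine ⟨_, isConjRoot_add_inv_pow hζ (k := 2 + w)
    (coprime_four_mul_of_odd (even_two.add_odd hw) (by simpa using hw.coprime_two_left)), ?_⟩
  rw [pow_add]
  generalize ζ ^ w = i at *
  field_simp
  linear_combination (ζ ^ 8 * i ^ 2 + 1) * hi₂

theorem add_inv_eq_add_inv_iff {K : Type*} [Field K] {x y : K} (hx : x ≠ 0) (hy : y ≠ 0) :
    x + x⁻¹ = y + y⁻¹ ↔ x = y ∨ x = y⁻¹ := by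
  have h : x + x⁻¹ - (y + y⁻¹) = (x - y) * (x - y⁻¹) / x := by
    field_simp
    ring
  rw [← sub_eq_zero, h, div_eq_zero_iff, mul_eq_zero, sub_eq_zero, sub_eq_zero, or_iff_left hx]

open IntermediateField in
theorem natDegree_minpoly_add_inv {E : Type*} [Field E] [CharZero E] [NeZero N]
    [IsCyclotomicExtension {N} ℚ E] {ζ : E} (hζ : IsPrimitiveRoot ζ N) (hN : 2 < N) :
    (minpoly ℚ (ζ + ζ⁻¹)).natDegree = N.totient / 2 := by
  have := IsCyclotomicExtension.isAbelianGalois {N} ℚ E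
  have := IsCyclotomicExtension.finiteDimensional {N} ℚ E
  have hζ₀ := hζ.ne_zero (NeZero.ne N)
  obtain ⟨c, hc⟩ : ∃ c : E ≃ₐ[ℚ] E, c ζ = ζ⁻¹ := by
    refine IsConjRoot.exists_algEquiv (.symm ?_)
    rw [IsConjRoot, ← Polynomial.cyclotomic_eq_minpoly_rat hζ (NeZero.pos N),
      ← Polynomial.cyclotomic_eq_minpoly_rat hζ.inv (NeZero.pos N)]
  have hext (σ τ : E ≃ₐ[ℚ] E) : σ = τ ↔ σ ζ = τ ζ := by
    refine ⟨fun h ↦ h ▸ rfl, fun h ↦ AlgEquiv.coe_toAlgHom_injective ?_⟩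
    exact (hζ.powerBasis ℚ).algHom_ext h
  have hc₁ : c ≠ 1 := by
    rw [Ne, hext, hc, AlgEquiv.one_apply, inv_eq_iff_eq_inv]
    intro h
    have hsq : ζ ^ 2 = 1 := by rw [sq, ← mul_inv_cancel₀ hζ₀, ← h]
    exact (Nat.le_of_dvd two_pos (hζ.dvd_of_pow_eq_one 2 hsq)).not_gt hN
  have hfix : (ℚ⟮ζ + ζ⁻¹⟯.fixingSubgroup : Set (E ≃ₐ[ℚ] E)) = {1, c} := by
    ext σ
    have hσ : σ ∈ ℚ⟮ζ + ζ⁻¹⟯.fixingSubgroup ↔ σ (ζ + ζ⁻¹) = ζ + ζ⁻¹ := by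
      simpa [mem_fixingSubgroup_iff] using forall_mem_adjoin_smul_eq_self_iff ℚ σ (S := {ζ + ζ⁻¹})
    rw [SetLike.mem_coe, hσ, map_add, map_inv₀,
      add_inv_eq_add_inv_iff (by simpa) hζ₀, Set.mem_insert_iff, Set.mem_singleton_iff, hext, hext,
      hc, AlgEquiv.one_apply]
  have hcard : Nat.card ℚ⟮ζ + ζ⁻¹⟯.fixingSubgroup = 2 := by
    rw [← Set.ncard_pair hc₁.symm, ← hfix]
    rfl
  rw [IsGalois.card_fixingSubgroup_eq_finrank] at hcard
  have h := Module.finrank_mul_finrank ℚ ℚ⟮ζ + ζ⁻¹⟯ E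
  rw [hcard, IsCyclotomicExtension.finrank E (Polynomial.cyclotomic.irreducible_rat (NeZero.pos N)),
    adjoin.finrank (IsIntegral.of_finite ℚ _)] at h
  lia

end Cyclotomic

section ConstantProduct

variable {E : Type*} [Field E] {w : ℕ} {ζ : E}

theorem pow_four_eq_of_isPrimitiveRoot_sixteen (hζ : IsPrimitiveRoot ζ (4 * 4)) :
    (ζ + ζ⁻¹) ^ 4 = 4 * (ζ + ζ⁻¹) ^ 2 - 2 := by
  have hζ₀ := hζ.ne_zero (by norm_num)
  have h := sq_pow_eq_neg_one_of_isPrimitiveRoot_four_mul hζ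
  field_simp
  linear_combination h

theorem pow_four_eq_of_isPrimitiveRoot_twenty (hζ : IsPrimitiveRoot ζ (4 * 5)) :
    (ζ + ζ⁻¹) ^ 4 = 5 * (ζ + ζ⁻¹) ^ 2 - 5 := by
  have hζ₀ := hζ.ne_zero (by norm_num)
  have h := sq_pow_eq_neg_one_of_isPrimitiveRoot_four_mul hζ
  have h₁ : ζ ^ 2 + 1 ≠ 0 := fun h₁ ↦
    hζ.pow_ne_one_of_pos_of_lt (l := 4) (by norm_num) (by norm_num)
      (by linear_combination (ζ ^ 2 - 1) * h₁)
  have h₂ : ζ ^ 8 - ζ ^ 6 + ζ ^ 4 - ζ ^ 2 + 1 = 0 :=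
    (mul_eq_zero.mp (by linear_combination h)).resolve_left h₁
  field_simp
  linear_combination h₂

variable [CharZero E] {τ : E ≃ₐ[ℚ] E} {r : ℚ}

theorem pow_four_eq_of_forall_mul_apply_eq_of_even [NeZero w] (hw : Even w)
    (hζ : IsPrimitiveRoot ζ (4 * w)) (h : ∀ γ, IsConjRoot ℚ (ζ + ζ⁻¹) γ → γ * τ γ = r) :
    (ζ + ζ⁻¹) ^ 4 = 4 * (ζ + ζ⁻¹) ^ 2 - r ^ 2 := by
  obtain ⟨γ, hγ, hsq⟩ := exists_isConjRoot_sq_eq_of_even hw hζ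
  have hτsq := congrArg τ hsq
  have hαr := h _ (IsConjRoot.refl (x := ζ + ζ⁻¹))
  have hγr := h γ hγ
  simp only [map_sub, map_pow, map_ofNat] at hτsq
  generalize ζ + ζ⁻¹ = α at *
  generalize τ γ = δ, τ α = β at *
  have hsum : α ^ 2 + β ^ 2 = 4 := by
    linear_combination -(1 / 4 : E) * (γ * δ + r) * hγr + (1 / 4 : E) * (α * β + r) * hαr +
      (1 / 4 : E) * (δ ^ 2 * hsq + (4 - α ^ 2) * hτsq)
  linear_combination α ^ 2 * hsum - (α * β + r) * hαr

theorem four_mul_pow_four_eq_of_forall_mul_apply_eq_of_odd (hw : Odd w)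
    (hζ : IsPrimitiveRoot ζ (4 * w)) (hr : r ≠ 0)
    (h : ∀ γ, IsConjRoot ℚ (ζ + ζ⁻¹) γ → γ * τ γ = r) :
    4 * (ζ + ζ⁻¹) ^ 4 = (15 + r ^ 2) * (ζ + ζ⁻¹) ^ 2 - 4 * r ^ 2 := by
  obtain ⟨γ, hγ, hsq⟩ := exists_isConjRoot_sq_eq_of_odd hw hζ
  have hτsq := congrArg τ hsq
  have hαr := h _ (IsConjRoot.refl (x := ζ + ζ⁻¹))
  have hγr := h γ hγ
  simp only [map_sub, map_mul, map_pow, map_ofNat] at hτsq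
  generalize ζ + ζ⁻¹ = α at *
  generalize τ γ = δ, τ α = β at *
  have hab : α ^ 2 * β ^ 2 = r ^ 2 := by linear_combination (α * β + r) * hαr
  have hprod : (4 - α ^ 2) * (4 - β ^ 2) = 1 := by
    refine mul_left_cancel₀ (pow_ne_zero 2 (Rat.cast_ne_zero.mpr hr : (r : E) ≠ 0)) ?_
    linear_combination (γ * δ + r) * hγr - (4 - α ^ 2) * (4 - β ^ 2) * hab - δ ^ 2 * hsq -
      α ^ 2 * (4 - α ^ 2) * hτsq
  linear_combination -α ^ 2 * hprod + (α ^ 2 - 4) * hab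

theorem ratCast_sq_ne_prime {p : ℕ} (hp : p.Prime) (r : ℚ) : r ^ 2 ≠ p := fun h ↦
  hp.prime.not_isSquare (Rat.isSquare_natCast_iff.mp ⟨r, by rw [← h, sq]⟩)

theorem exists_isConjRoot_mul_apply_ne_of_even [NeZero w] (hw : Even w)
    (hζ : IsPrimitiveRoot ζ (4 * w)) (hw₄ : w = 4 ∨ 4 < (minpoly ℚ (ζ + ζ⁻¹)).natDegree)
    (τ : E ≃ₐ[ℚ] E) (r : ℚ) : ∃ γ, IsConjRoot ℚ (ζ + ζ⁻¹) γ ∧ γ * τ γ ≠ r := by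
  by_contra! h
  have hrel := pow_four_eq_of_forall_mul_apply_eq_of_even hw hζ h
  rcases hw₄ with rfl | hdeg
  · rw [pow_four_eq_of_isPrimitiveRoot_sixteen hζ, sub_right_inj] at hrel
    exact ratCast_sq_ne_prime Nat.prime_two r (by exact_mod_cast hrel.symm)
  · have hc : ![r ^ 2, 0, -4, 0, 1] = 0 := by
      refine eq_zero_of_sum_mul_pow_eq_zero (α := ζ + ζ⁻¹) hdeg ?_
      simp only [Fin.sum_univ_five, Matrix.cons_val, Fin.isValue, Fin.coe_ofNat_eq_mod]
      push_cast
      linear_combination hrel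
    simpa using congrFun hc 4

theorem exists_isConjRoot_mul_apply_ne_of_odd (hw : Odd w) (hζ : IsPrimitiveRoot ζ (4 * w))
    (hα : 2 < (minpoly ℚ (ζ + ζ⁻¹)).natDegree)
    (hw₅ : w = 5 ∨ 4 < (minpoly ℚ (ζ + ζ⁻¹)).natDegree) (τ : E ≃ₐ[ℚ] E) (r : ℚ) :
    ∃ γ, IsConjRoot ℚ (ζ + ζ⁻¹) γ ∧ γ * τ γ ≠ r := by
  by_contra! h
  have hr : r ≠ 0 := by
    rintro rfl
    have h₀ := h _ (IsConjRoot.refl (x := ζ + ζ⁻¹))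
    rw [Rat.cast_zero, mul_eq_zero, map_eq_zero_iff τ τ.injective, or_self] at h₀
    simp [h₀] at hα
  have hrel := four_mul_pow_four_eq_of_forall_mul_apply_eq_of_odd hw hζ hr h
  rcases hw₅ with rfl | hdeg
  · have hc : ![4 * (r ^ 2 - 5), 0, 5 - r ^ 2] = 0 := by
      refine eq_zero_of_sum_mul_pow_eq_zero (α := ζ + ζ⁻¹) hα ?_
      simp only [Fin.sum_univ_three, Matrix.cons_val, Fin.isValue, Fin.coe_ofNat_eq_mod]
      push_cast
      linear_combination hrel - 4 * pow_four_eq_of_isPrimitiveRoot_twenty hζ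
    exact ratCast_sq_ne_prime Nat.prime_five r (sub_eq_zero.mp (congrFun hc 2)).symm
  · have hc : ![4 * r ^ 2, 0, -(15 + r ^ 2), 0, 4] = 0 := by
      refine eq_zero_of_sum_mul_pow_eq_zero (α := ζ + ζ⁻¹) hdeg ?_
      simp only [Fin.sum_univ_five, Matrix.cons_val, Fin.isValue, Fin.coe_ofNat_eq_mod]
      push_cast
      linear_combination hrel
    simpa using congrFun hc 4

theorem exists_isConjRoot_mul_apply_ne [NeZero w] (hζ : IsPrimitiveRoot ζ (4 * w))
    (hα : 2 < (minpoly ℚ (ζ + ζ⁻¹)).natDegree)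
    (hw : w = 4 ∨ w = 5 ∨ 4 < (minpoly ℚ (ζ + ζ⁻¹)).natDegree) (τ : E ≃ₐ[ℚ] E) (r : ℚ) :
    ∃ γ, IsConjRoot ℚ (ζ + ζ⁻¹) γ ∧ γ * τ γ ≠ r := by
  rcases w.even_or_odd with heven | hodd
  · exact exists_isConjRoot_mul_apply_ne_of_even heven hζ
      (hw.imp_right fun hw ↦ hw.resolve_left (by grind)) τ r
  · exact exists_isConjRoot_mul_apply_ne_of_odd hodd hζ hα (hw.resolve_left (by grind)) τ r

end ConstantProduct

section Sine

/-- The order of the root of unity `ζ = exp (2πi (1/4 - 1/n))`, for which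
`2 sin (2π/n) = ζ + ζ⁻¹`. -/
def sinOrder (n : ℕ) : ℕ :=
  (1 / 4 - 1 / n : ℚ).den

instance (n : ℕ) : NeZero (sinOrder n) :=
  ⟨Rat.den_nz _⟩

theorem sinPoly_eq_minpoly_add_inv {K : Type*} [Field K] [CharZero K] {n : ℕ} {ζ : K}
    (hζ : IsPrimitiveRoot ζ (sinOrder n)) : sinPoly n = minpoly ℚ (ζ + ζ⁻¹) := by
  rw [minpoly_add_inv_eq hζ (Complex.isPrimitiveRoot_exp_rat (1 / 4 - 1 / n)), sinPoly,
    ← minpoly.algebraMap_eq Complex.ofReal_injective]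
  congr 1
  have hangle : (Real.pi / 2 - 2 * Real.pi / n : ℂ) * Complex.I =
      2 * Real.pi * Complex.I * ((1 / 4 - 1 / n : ℚ) : ℂ) := by
    push_cast
    ring
  rw [Complex.coe_algebraMap, ← Real.cos_pi_div_two_sub, ← Complex.exp_neg, ← hangle, ← neg_mul]
  push_cast
  rw [Complex.two_cos]

theorem sinForm_eq_minpolyForm {K : Type*} [Field K] [CharZero K] {n : ℕ} {ζ : K}
    (hζ : IsPrimitiveRoot ζ (sinOrder n)) : sinForm n = minpolyForm (ζ + ζ⁻¹) := by
  rw [sinForm, minpolyForm, sinPoly_eq_minpoly_add_inv hζ]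

theorem sinOrder_eq_of_isCoprime {n b : ℕ} {a : ℤ} (hn : 0 < n) (hb : 0 < b)
    (hab : IsCoprime a b) (h : 4 * n * a = b * (n - 4 : ℤ)) : sinOrder n = b := by
  have hq : (1 / 4 - 1 / n : ℚ) = a / (b : ℤ) := by
    have h : (4 * n * a : ℚ) = b * (n - 4) := by exact_mod_cast h
    rw [Int.cast_natCast]
    field_simp
    linear_combination -h
  have hden :=
    Rat.den_div_eq_of_coprime (Int.natCast_pos.mpr hb) (Int.isCoprime_iff_nat_coprime.mp hab)
  rw [sinOrder, hq]
  exact_mod_cast hden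

theorem isCoprime_sub_two_pow_four_mul {m : ℤ} (hm : Odd m) {j : ℕ} (hj : j ≠ 0) :
    IsCoprime (m - 2 ^ j) (4 * m) := by
  refine .mul_right ?_ ?_
  · have h := Int.isCoprime_two_right.mpr (hm.sub_even (even_two.pow_of_ne_zero hj))
    exact h.pow_right (n := 2)
  · have h := (Int.isCoprime_two_left.mpr hm).pow_left (m := j)
    simpa [sub_eq_neg_add] using h.neg_left.add_mul_left_left 1

theorem sinOrder_of_odd {n : ℕ} (hn : Odd n) : sinOrder n = 4 * n := by
  have h := isCoprime_sub_two_pow_four_mul (m := n) (by exact_mod_cast hn) two_ne_zero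
  exact sinOrder_eq_of_isCoprime hn.pos (by simp [hn.pos]) (by push_cast; exact h)
    (by push_cast; ring)

theorem sinOrder_two_mul_of_odd {m : ℕ} (hm : Odd m) : sinOrder (2 * m) = 4 * m := by
  have h := isCoprime_sub_two_pow_four_mul (m := m) (by exact_mod_cast hm) one_ne_zero
  exact sinOrder_eq_of_isCoprime (by simp [hm.pos]) (by simp [hm.pos]) (by push_cast; exact h)
    (by push_cast; ring)

theorem sinOrder_eight_mul {k : ℕ} (hk : 0 < k) : sinOrder (8 * k) = 8 * k :=
  sinOrder_eq_of_isCoprime (a := 2 * k - 1) (by lia) (by lia)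
    ⟨-(2 * k + 1) * (4 * k ^ 2 + 1), 2 * k ^ 3, by push_cast; ring⟩ (by push_cast; ring)

theorem sinOrder_four_mul_four_mul_add_one (k : ℕ) : sinOrder (4 * (4 * k + 1)) = 4 * k + 1 :=
  sinOrder_eq_of_isCoprime (a := k) (by lia) (by lia) ⟨-4, 1, by push_cast; ring⟩
    (by push_cast; ring)

theorem sinOrder_four_mul_four_mul_add_three (k : ℕ) :
    sinOrder (4 * (4 * k + 3)) = 2 * (4 * k + 3) :=
  sinOrder_eq_of_isCoprime (a := 2 * k + 1) (by lia) (by lia)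
    ⟨4 * k + 1, -k, by push_cast; ring⟩ (by push_cast; ring)

theorem sinOrder_cases {P : ℕ → ℕ → Prop} (odd : ∀ m, Odd m → P m (4 * m))
    (two_mul_odd : ∀ m, Odd m → P (2 * m) (4 * m))
    (eight_mul : ∀ k, 0 < k → P (8 * k) (8 * k))
    (four_mul_add_one : ∀ k, P (4 * (4 * k + 1)) (4 * k + 1))
    (four_mul_add_three : ∀ k, P (4 * (4 * k + 3)) (2 * (4 * k + 3))) {n : ℕ} (hn : 0 < n) :
    P n (sinOrder n) := by
  obtain h | ⟨m, h, rfl⟩ | ⟨k, h, rfl⟩ | ⟨k, rfl⟩ | ⟨k, rfl⟩ : Odd n ∨ (∃ m, Odd m ∧ n = 2 * m) ∨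
      (∃ k, 0 < k ∧ n = 8 * k) ∨ (∃ k, n = 4 * (4 * k + 1)) ∨ ∃ k, n = 4 * (4 * k + 3) := by
    have key : Odd n ∨ Odd (n / 2) ∧ n = 2 * (n / 2) ∨ 0 < n / 8 ∧ n = 8 * (n / 8) ∨
      n = 4 * (4 * (n / 16) + 1) ∨ n = 4 * (4 * (n / 16) + 3) := by grind
    exact key.imp_right (.imp (⟨_, ·⟩) (.imp (⟨_, ·⟩) (.imp (⟨_, ·⟩) (⟨_, ·⟩))))
  · exact sinOrder_of_odd h ▸ odd n h
  · exact sinOrder_two_mul_of_odd h ▸ two_mul_odd m h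
  · exact (sinOrder_eight_mul h).symm ▸ eight_mul k h
  · exact (sinOrder_four_mul_four_mul_add_one k).symm ▸ four_mul_add_one k
  · exact (sinOrder_four_mul_four_mul_add_three k).symm ▸ four_mul_add_three k

theorem two_lt_sinOrder {n : ℕ} (hn : 4 < n) : 2 < sinOrder n := by
  refine sinOrder_cases (P := fun n N ↦ 4 < n → 2 < N) ?_ ?_ ?_ ?_ ?_ (zero_lt_four.trans hn) hn <;>
    grind

theorem four_dvd_sinOrder_iff {n : ℕ} (hn : 0 < n) : 4 ∣ sinOrder n ↔ n % 8 ≠ 4 := by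
  refine sinOrder_cases (P := fun n N ↦ 4 ∣ N ↔ n % 8 ≠ 4) ?_ ?_ ?_ ?_ ?_ hn <;> grind

theorem gcd_eight (n : ℕ) : n.gcd 8 = (n % 8).gcd 8 := by
  rw [Nat.gcd_comm, Nat.gcd_rec]

theorem sinDegree_of_mod_eight_eq_four {n : ℕ} (h : n % 8 = 4) : sinDegree n = n.totient / 4 := by
  simp [sinDegree, gcd_eight n, h]

theorem sinDegree_of_mod_eight_eq_zero {n : ℕ} (h : n % 8 = 0) : sinDegree n = n.totient / 2 := by
  simp [sinDegree, gcd_eight n, h]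

theorem sinDegree_of_mod_four_ne_zero {n : ℕ} (h : n % 4 ≠ 0) : sinDegree n = n.totient := by
  have h8 : n % 8 = 1 ∨ n % 8 = 2 ∨ n % 8 = 3 ∨ n % 8 = 5 ∨ n % 8 = 6 ∨ n % 8 = 7 := by lia
  rcases h8 with h | h | h | h | h | h <;> simp [sinDegree, gcd_eight n, h]

theorem totient_four_mul_of_odd {m : ℕ} (hm : Odd m) : (4 * m).totient = 2 * m.totient := by
  have h : Nat.totient 4 = 2 := by decide
  rw [Nat.totient_mul (hm.coprime_two_left.pow_left 2), h]

theorem totient_sinOrder_div_two {n : ℕ} (hn : 0 < n) :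
    (sinOrder n).totient / 2 = sinDegree n := by
  refine sinOrder_cases (P := fun n N ↦ N.totient / 2 = sinDegree n)
    (fun m hm ↦ ?_) (fun m hm ↦ ?_) (fun k _ ↦ ?_) (fun k ↦ ?_) (fun k ↦ ?_) hn
  · rw [sinDegree_of_mod_four_ne_zero (by grind), totient_four_mul_of_odd hm]
    lia
  · rw [sinDegree_of_mod_four_ne_zero (by grind), totient_four_mul_of_odd hm,
      Nat.totient_two_mul_of_odd hm]
    lia
  · rw [sinDegree_of_mod_eight_eq_zero (by lia)]
  · rw [sinDegree_of_mod_eight_eq_four (by lia), totient_four_mul_of_odd (by grind)]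
    lia
  · have hodd : Odd (4 * k + 3) := by grind
    rw [sinDegree_of_mod_eight_eq_four (by lia), totient_four_mul_of_odd hodd,
      Nat.totient_two_mul_of_odd hodd]
    lia

theorem le_totient_sq_and_le_two_mul_totient_sq {n : ℕ} (hn : 0 < n) :
    (Odd n → n ≤ n.totient ^ 2) ∧ n ≤ 2 * n.totient ^ 2 := by
  induction n using Nat.recOnPosPrimePosCoprime with
  | prime_pow p k hp hk =>
    obtain ⟨j, rfl⟩ := Nat.exists_eq_add_one_of_ne_zero hk.ne'
    have hpow : p ^ j ≤ (p ^ j) ^ 2 := Nat.le_self_pow two_ne_zero _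
    rw [Nat.totient_prime_pow_succ hp, mul_pow, pow_succ]
    rcases hp.eq_two_or_odd' with rfl | hodd
    · exact ⟨fun h ↦ by grind, by lia⟩
    · have hp₃ : 3 ≤ p := by
        have := hp.two_le
        grind
      have hle : p ≤ (p - 1) ^ 2 := by
        obtain ⟨q, rfl⟩ := Nat.exists_eq_add_of_le' hp₃
        simp only [Nat.add_succ_sub_one]
        nlinarith
      have := Nat.mul_le_mul hpow hle
      exact ⟨fun _ ↦ this, by lia⟩
  | zero => simp at hn
  | one => simp
  | coprime a b ha hb hab iha ihb =>
    obtain ⟨ha₁, ha₂⟩ := iha (zero_lt_one.trans ha)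
    obtain ⟨hb₁, hb₂⟩ := ihb (zero_lt_one.trans hb)
    rw [Nat.totient_mul hab, mul_pow]
    refine ⟨fun h ↦ ?_, ?_⟩
    · rw [Nat.odd_mul] at h
      exact Nat.mul_le_mul (ha₁ h.1) (hb₁ h.2)
    · rcases a.even_or_odd with heven | hodd
      · have hodd : Odd b := (hab.coprime_dvd_left heven.two_dvd).odd_of_left
        calc
          a * b ≤ (2 * a.totient ^ 2) * b.totient ^ 2 := Nat.mul_le_mul ha₂ (hb₁ hodd)
          _ = 2 * (a.totient ^ 2 * b.totient ^ 2) := by ring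
      · calc
          a * b ≤ a.totient ^ 2 * (2 * b.totient ^ 2) := Nat.mul_le_mul (ha₁ hodd) hb₂
          _ = 2 * (a.totient ^ 2 * b.totient ^ 2) := by ring

theorem mem_of_totient_lt_ten {N : ℕ} (hN : 0 < N) (h : N.totient < 10) :
    N ∈ ({1, 2, 3, 4, 5, 6, 7, 8, 9, 10, 12, 14, 15, 16, 18, 20, 24, 30} : Finset ℕ) := by
  have hdec : ∀ N < 163, 0 < N → N.totient < 10 →
      N ∈ ({1, 2, 3, 4, 5, 6, 7, 8, 9, 10, 12, 14, 15, 16, 18, 20, 24, 30} : Finset ℕ) := by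
    decide +kernel
  have hle : N ≤ 2 * 9 ^ 2 := by
    calc
      N ≤ 2 * N.totient ^ 2 := (le_totient_sq_and_le_two_mul_totient_sq hN).2
      _ ≤ 2 * 9 ^ 2 := by gcongr; lia
  exact hdec N (by lia) hN h

theorem mem_of_sinDegree_lt_five {n : ℕ} (hn : 0 < n) (h : sinDegree n < 5) :
    n ∈ ({1, 2, 3, 4, 5, 6, 8, 10, 12, 16, 20, 24, 28, 36, 60} : Finset ℕ) := by
  have hN := mem_of_totient_lt_ten (NeZero.pos (sinOrder n))
    (by have := totient_sinOrder_div_two hn; lia)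
  revert hN
  refine sinOrder_cases (P := fun n N ↦
    N ∈ ({1, 2, 3, 4, 5, 6, 7, 8, 9, 10, 12, 14, 15, 16, 18, 20, 24, 30} : Finset ℕ) →
      n ∈ ({1, 2, 3, 4, 5, 6, 8, 10, 12, 16, 20, 24, 28, 36, 60} : Finset ℕ))
    ?_ ?_ ?_ ?_ ?_ hn <;>
  simp only [Finset.mem_insert, Finset.mem_singleton, Nat.odd_iff] <;> omega

theorem three_le_sinDegree {n : ℕ} (hpos : 0 < n)
    (hn : n ∉ ({1, 2, 3, 4, 6, 8, 12, 20} : Finset ℕ)) : 3 ≤ sinDegree n := by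
  by_contra! h
  have hdec : ∀ n ∈ ({1, 2, 3, 4, 5, 6, 8, 10, 12, 16, 20, 24, 28, 36, 60} : Finset ℕ),
      sinDegree n < 3 → n ∈ ({1, 2, 3, 4, 6, 8, 12, 20} : Finset ℕ) := by
    unfold sinDegree
    decide
  exact hn (hdec n (mem_of_sinDegree_lt_five hpos (by lia)) h)

end Sine

section Degree

variable {n : ℕ}

instance isCyclotomicExtension_cyclotomicField_rat (N : ℕ) [NeZero N] :
    IsCyclotomicExtension {N} ℚ (CyclotomicField N ℚ) := by
  rw [Subsingleton.elim DivisionRing.toRatAlgebra (CyclotomicField.algebra N ℚ)]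
  exact CyclotomicField.isCyclotomicExtension N ℚ

theorem natDegree_sinPoly (hn : 4 < n) : (sinPoly n).natDegree = sinDegree n := by
  have hζ := IsCyclotomicExtension.zeta_spec (sinOrder n) ℚ (CyclotomicField (sinOrder n) ℚ)
  rw [sinPoly_eq_minpoly_add_inv hζ, natDegree_minpoly_add_inv hζ (two_lt_sinOrder hn),
    totient_sinOrder_div_two (by lia)]

end Degree

noncomputable section Exceptional

open Polynomial

variable {K : Type*} [Field K] [CharZero K] {α β : K} {a : ℚ}

theorem minpoly_eq_of_natDegree_le {p : ℚ[X]} (hp : p.Monic) (hα : aeval α p = 0)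
    (hdeg : p.natDegree ≤ (minpoly ℚ α).natDegree) : minpoly ℚ α = p :=
  (eq_of_monic_of_dvd_of_natDegree_le (minpoly.monic ⟨p, hp, hα⟩) hp (minpoly.dvd ℚ α hα) hdeg).symm

/-- Shanks' simplest cubic `x³ + a x² - (a + 3) x + 1`, whose roots are permuted cyclically by
`x ↦ (x - 1) / x`. -/
def simplestCubic (a : ℚ) : ℚ[X] :=
  X ^ 3 + C a * X ^ 2 - C (a + 3) * X + 1

theorem natDegree_simplestCubic (a : ℚ) : (simplestCubic a).natDegree = 3 := by
  unfold simplestCubic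
  compute_degree!

theorem monic_simplestCubic (a : ℚ) : (simplestCubic a).Monic := by
  unfold simplestCubic
  monicity!

theorem aeval_simplestCubic (α : K) (a : ℚ) :
    aeval α (simplestCubic a) = α ^ 3 + a * α ^ 2 - (a + 3) * α + 1 := by
  simp [simplestCubic]

theorem homogenize_simplestCubic (a : ℚ) : (simplestCubic a).homogenize 3 =
    .X 0 ^ 3 + .C a * .X 0 ^ 2 * .X 1 - .C (a + 3) * .X 0 * .X 1 ^ 2 + .X 1 ^ 3 := by
  rw [simplestCubic]
  simp only [homogenize_add, homogenize_sub, Std.le_refl, homogenize_X_pow, Fin.isValue, tsub_self,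
    pow_zero, mul_one, homogenize_C_mul, Nat.reduceLeDiff, Nat.reduceSub, pow_one,
    MvPolynomial.C_add, ne_eq, OfNat.ofNat_ne_zero, not_false_eq_true, homogenize_X,
    Nat.add_one_sub_one, homogenize_one, mul_assoc]

theorem glMatrices_le_formAut_of_minpoly_eq_simplestCubic (h : minpoly ℚ α = simplestCubic a) :
    glMatrices (glSpan {!![-1, 1; -1, 0]}) ≤ formAut (minpolyForm α) := by
  refine glMatrices_glSpan_le_formAut (Set.singleton_subset_iff.mpr ?_)
  change formSubst _ _ = _
  rw [minpolyForm, h, natDegree_simplestCubic, homogenize_simplestCubic]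
  have hC : (.C 3 : MvPolynomial (Fin 2) ℚ) = 3 := map_ofNat _ 3
  simp only [formSubst, map_add, map_sub, map_mul, map_pow, MvPolynomial.bind₁_X_right,
    MvPolynomial.bind₁_C_right, Matrix.of_apply, Matrix.cons_val, map_neg, map_one, map_zero]
  rw [hC]
  ring

theorem RealizesFormAbsAut.of_minpoly_eq_simplestCubic (h : minpoly ℚ α = simplestCubic a) :
    RealizesFormAbsAut (glMatrices (glSpan {!![-1, 1; -1, 0]})) α := by
  intro M hM
  have hdeg : 1 < (minpoly ℚ α).natDegree := by
    rw [h, natDegree_simplestCubic]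
    norm_num
  obtain ⟨β, hβ, hMβ⟩ := exists_isConjRoot_moebiusMaps hdeg hM
  have hα₀ : α ≠ 0 := by simpa using ne_ratCast_of_one_lt_natDegree hdeg 0
  have hα₁ : α - 1 ≠ 0 := by
    rw [sub_ne_zero]
    simpa using ne_ratCast_of_one_lt_natDegree hdeg 1
  have hαr := minpoly.aeval ℚ α
  have hβr := minpoly.aeval ℚ β
  rw [h, aeval_simplestCubic] at hαr
  rw [← show _ = _ from hβ, h, aeval_simplestCubic] at hβr
  have hgen := mem_glMatrices_glSpan (M := !![-1, 1; -1, 0]) (Set.mem_singleton _) (by simp)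
  have hroots : (β - α) * (α * β - α + 1) * (β * (1 - α) - 1) = 0 := by
    linear_combination α * (1 - α) * hβr - (β - β ^ 2) * hαr
  rcases mul_eq_zero.mp hroots with hroots | hβ
  · rcases mul_eq_zero.mp hroots with hβ | hβ
    · exact ⟨1, one_mem _, β, hMβ, by rw [sub_eq_zero.mp hβ]; exact .one α⟩
    · refine ⟨!![-1, 1; -1, 0], hgen, β, hMβ, ?_, ?_⟩
      · simpa
      · simp only [Matrix.of_apply, Matrix.cons_val]
        push_cast
        linear_combination hβ
  · have hsq : !![-1, 1; -1, 0] ^ 2 = (!![0, -1; 1, -1] : Matrix (Fin 2) (Fin 2) ℚ) := by simp [sq]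
    refine ⟨!![0, -1; 1, -1], hsq ▸ pow_mem hgen 2, β, hMβ, ?_, ?_⟩
    · simpa [sub_eq_add_neg] using hα₁
    · simp only [Matrix.of_apply, Matrix.cons_val]
      push_cast
      linear_combination hβ

theorem formAut_eq_of_minpoly_eq_simplestCubic (h : minpoly ℚ α = simplestCubic a) :
    formAut (minpolyForm α) = glMatrices (glSpan {!![-1, 1; -1, 0]}) := by
  have hdeg : (minpoly ℚ α).natDegree = 3 := h ▸ natDegree_simplestCubic a
  exact (RealizesFormAbsAut.of_minpoly_eq_simplestCubic h).formAut_eq_of_odd (by lia)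
    (glMatrices_le_formAut_of_minpoly_eq_simplestCubic h) (by rw [hdeg]; decide)

theorem formAbsAut_eq_of_minpoly_eq_simplestCubic (h : minpoly ℚ α = simplestCubic a) :
    formAbsAut (minpolyForm α) = glMatrices (glSpan {!![-1, 1; -1, 0], !![-1, 0; 0, -1]}) := by
  have hdeg : (minpoly ℚ α).natDegree = 3 := h ▸ natDegree_simplestCubic a
  have hgen : !![-1, 1; -1, 0] ∈ formAbsAut (minpolyForm α) :=
    formAut_le_formAbsAut _ (glMatrices_le_formAut_of_minpoly_eq_simplestCubic h
      (mem_glMatrices_glSpan rfl (by simp)))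
  have hneg : !![-1, 0; 0, -1] ∈ formAbsAut (minpolyForm α) :=
    neg_one_fin_two ▸ neg_one_mem_formAbsAut (isHomogeneous_minpolyForm α)
  refine ((RealizesFormAbsAut.of_minpoly_eq_simplestCubic h).mono
    (glMatrices_glSpan_mono (Set.subset_insert_iff.mpr ?_))).formAbsAut_eq (by lia)
    (glMatrices_glSpan_le_formAbsAut (Set.pair_subset hgen hneg)) ?_
  · simp
  · exact mem_glMatrices_glSpan (Or.inr neg_one_fin_two.symm) (by simp [Matrix.det_neg])

end Exceptional

noncomputable section Quartics

open Polynomial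

variable {K : Type*} [Field K] [CharZero K] {α β : K} {a : ℚ}
  {M : Matrix (Fin 2) (Fin 2) ℚ}

/-- The reciprocal quartic `x⁴ + a x² + 1`, whose roots are permuted by `x ↦ ± x ^ (± 1)`. -/
def evenReciprocalQuartic (a : ℚ) : ℚ[X] :=
  X ^ 4 + C a * X ^ 2 + 1

theorem natDegree_evenReciprocalQuartic (a : ℚ) : (evenReciprocalQuartic a).natDegree = 4 := by
  unfold evenReciprocalQuartic
  compute_degree!

theorem monic_evenReciprocalQuartic (a : ℚ) : (evenReciprocalQuartic a).Monic := by
  unfold evenReciprocalQuartic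
  monicity!

theorem aeval_evenReciprocalQuartic (α : K) (a : ℚ) :
    aeval α (evenReciprocalQuartic a) = α ^ 4 + a * α ^ 2 + 1 := by
  simp [evenReciprocalQuartic]

theorem homogenize_evenReciprocalQuartic (a : ℚ) : (evenReciprocalQuartic a).homogenize 4 =
    .X 0 ^ 4 + .C a * .X 0 ^ 2 * .X 1 ^ 2 + .X 1 ^ 4 := by
  rw [evenReciprocalQuartic]
  simp only [homogenize_add, Std.le_refl, homogenize_X_pow, Fin.isValue, tsub_self, pow_zero,
    mul_one, homogenize_C_mul, Nat.reduceLeDiff, Nat.reduceSub, homogenize_one, mul_assoc]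

theorem glMatrices_groupD4_le_formAut (h : minpoly ℚ α = evenReciprocalQuartic a) :
    glMatrices groupD4 ≤ formAut (minpolyForm α) := by
  refine glMatrices_glSpan_le_formAut (Set.pair_subset ?_ ?_) <;> change formSubst _ _ = _ <;>
    rw [minpolyForm, h, natDegree_evenReciprocalQuartic, homogenize_evenReciprocalQuartic] <;>
    simp only [formSubst, map_add, map_mul, map_pow, MvPolynomial.bind₁_X_right,
      MvPolynomial.bind₁_C_right, Matrix.of_apply, Matrix.cons_val, map_neg, map_one, map_zero] <;>
    ring

theorem neg_one_mem_glMatrices_groupD4 : -1 ∈ glMatrices groupD4 := by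
  have hJ : !![0, 1; -1, 0] ∈ glMatrices groupD4 := mem_glMatrices_glSpan (Or.inr rfl) (by simp)
  simpa [sq, neg_one_fin_two] using pow_mem hJ 2

theorem RealizesFormAbsAut.of_minpoly_eq_evenReciprocalQuartic
    (h : minpoly ℚ α = evenReciprocalQuartic a) : RealizesFormAbsAut (glMatrices groupD4) α := by
  intro M hM
  have hdeg : 1 < (minpoly ℚ α).natDegree := by
    rw [h, natDegree_evenReciprocalQuartic]
    norm_num
  obtain ⟨β, hβ, hMβ⟩ := exists_isConjRoot_moebiusMaps hdeg hM
  have hα₀ : α ≠ 0 := by simpa using ne_ratCast_of_one_lt_natDegree hdeg 0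
  have hαr := minpoly.aeval ℚ α
  have hβr := minpoly.aeval ℚ β
  rw [h, aeval_evenReciprocalQuartic] at hαr
  rw [← show _ = _ from hβ, h, aeval_evenReciprocalQuartic] at hβr
  have hS : !![0, 1; 1, 0] ∈ glMatrices groupD4 := mem_glMatrices_glSpan (Or.inl rfl) (by simp)
  have hJ : !![0, 1; -1, 0] ∈ glMatrices groupD4 := mem_glMatrices_glSpan (Or.inr rfl) (by simp)
  have hSJ : !![-1, 0; 0, 1] ∈ glMatrices groupD4 := by simpa using mul_mem hS hJ
  have hroots : (β - α) * (β + α) * ((α * β - 1) * (α * β + 1)) = 0 := by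
    linear_combination α ^ 2 * hβr - β ^ 2 * hαr
  simp only [mul_eq_zero] at hroots
  rcases hroots with (hβ | hβ) | hβ | hβ
  · exact ⟨1, one_mem _, β, hMβ, sub_eq_zero.mp hβ ▸ .one α⟩
  · refine ⟨_, hSJ, β, hMβ, by simp, ?_⟩
    simp only [Matrix.of_apply, Matrix.cons_val]
    push_cast
    linear_combination -hβ
  · refine ⟨_, hS, β, hMβ, by simpa, ?_⟩
    simp only [Matrix.of_apply, Matrix.cons_val]
    push_cast
    linear_combination -hβ
  · refine ⟨_, hJ, β, hMβ, by simpa, ?_⟩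
    simp only [Matrix.of_apply, Matrix.cons_val]
    push_cast
    linear_combination hβ

theorem formAut_eq_of_minpoly_eq_evenReciprocalQuartic
    (h : minpoly ℚ α = evenReciprocalQuartic a) :
    formAut (minpolyForm α) = glMatrices groupD4 :=
  (RealizesFormAbsAut.of_minpoly_eq_evenReciprocalQuartic h).formAut_eq_of_neg_one_mem
    (by rw [h, natDegree_evenReciprocalQuartic]; norm_num) (glMatrices_groupD4_le_formAut h)
    neg_one_mem_glMatrices_groupD4

theorem formAbsAut_eq_of_minpoly_eq_evenReciprocalQuartic
    (h : minpoly ℚ α = evenReciprocalQuartic a) :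
    formAbsAut (minpolyForm α) = glMatrices groupD4 :=
  (RealizesFormAbsAut.of_minpoly_eq_evenReciprocalQuartic h).formAbsAut_eq
    (by rw [h, natDegree_evenReciprocalQuartic]; norm_num)
    ((glMatrices_groupD4_le_formAut h).trans (formAut_le_formAbsAut _))
    neg_one_mem_glMatrices_groupD4

/-- The quartic `x⁴ + x³ - 4x² - 4x + 1`, which is the minimal polynomial of `2 sin(2π/60)`. -/
def sinQuarticSixty : ℚ[X] :=
  X ^ 4 + X ^ 3 - C 4 * X ^ 2 - C 4 * X + 1

theorem natDegree_sinQuarticSixty : sinQuarticSixty.natDegree = 4 := by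
  unfold sinQuarticSixty
  compute_degree!

theorem monic_sinQuarticSixty : sinQuarticSixty.Monic := by
  unfold sinQuarticSixty
  monicity!

theorem aeval_sinQuarticSixty (α : K) :
    aeval α sinQuarticSixty = α ^ 4 + α ^ 3 - 4 * α ^ 2 - 4 * α + 1 := by
  simp [sinQuarticSixty]

theorem homogenize_sinQuarticSixty : sinQuarticSixty.homogenize 4 =
    .X 0 ^ 4 + .X 0 ^ 3 * .X 1 - .C 4 * .X 0 ^ 2 * .X 1 ^ 2 - .C 4 * .X 0 * .X 1 ^ 3 +
      .X 1 ^ 4 := by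
  rw [sinQuarticSixty]
  simp only [homogenize_add, homogenize_sub, Std.le_refl, homogenize_X_pow, Fin.isValue, tsub_self,
    pow_zero, mul_one, Nat.reduceLeDiff, Nat.reduceSub, pow_one, homogenize_C_mul, ne_eq,
    OfNat.ofNat_ne_zero, not_false_eq_true, homogenize_X, Nat.add_one_sub_one, homogenize_one,
    mul_assoc]

theorem glMatrices_le_formAut_of_minpoly_eq_sinQuarticSixty (h : minpoly ℚ α = sinQuarticSixty) :
    glMatrices (glSpan {!![1, 2; -1, -1]}) ≤ formAut (minpolyForm α) := by
  refine glMatrices_glSpan_le_formAut (Set.singleton_subset_iff.mpr ?_)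
  change formSubst _ _ = _
  have h₂ : (.C 2 : MvPolynomial (Fin 2) ℚ) = 2 := map_ofNat _ 2
  have h₄ : (.C 4 : MvPolynomial (Fin 2) ℚ) = 4 := map_ofNat _ 4
  rw [minpolyForm, h, natDegree_sinQuarticSixty, homogenize_sinQuarticSixty]
  simp only [formSubst, map_add, map_sub, map_mul, map_pow, MvPolynomial.bind₁_X_right,
    MvPolynomial.bind₁_C_right, Matrix.of_apply, Matrix.cons_val, map_neg, map_one]
  rw [h₂, h₄]
  ring

theorem neg_one_mem_glMatrices_sixty : -1 ∈ glMatrices (glSpan {!![1, 2; -1, -1]}) := by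
  have hgen : !![1, 2; -1, -1] ∈ glMatrices (glSpan {!![1, 2; -1, -1]}) :=
    mem_glMatrices_glSpan rfl (by norm_num)
  convert pow_mem hgen 2 using 1
  rw [← neg_one_fin_two]
  norm_num [sq]

theorem eq_or_eq_of_isRoot_sinQuarticSixty (hα : aeval α sinQuarticSixty = 0)
    (hβ : aeval β sinQuarticSixty = 0) :
    (β = α ∨ β = α ^ 3 - 4 * α - 1) ∨ β = 2 - α ^ 2 ∨ β = -α ^ 3 + α ^ 2 + 3 * α - 2 := by
  rw [aeval_sinQuarticSixty] at hα hβ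
  have hroots : ((β - α) * (β - (α ^ 3 - 4 * α - 1))) *
      ((β - (2 - α ^ 2)) * (β - (-α ^ 3 + α ^ 2 + 3 * α - 2))) = 0 := by
    linear_combination hβ + (-1 + 6 * α ^ 2 - 3 * α ^ 3 - 2 * α ^ 4 + α ^ 5 +
      β * (-6 * α + α ^ 2 + 3 * α ^ 3 - α ^ 4) + β ^ 2 * (2 * α - α ^ 2)) * hα
  simpa only [mul_eq_zero, sub_eq_zero] using hroots

theorem not_moebiusMaps_two_sub_sq (hα : 4 ≤ (minpoly ℚ α).natDegree) :
    ¬MoebiusMaps M α (2 - α ^ 2) := by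
  intro h
  have hc : ![M 0 1 - 2 * M 1 1, M 0 0 - 2 * M 1 0, M 1 1, M 1 0] = 0 := by
    refine eq_zero_of_sum_mul_pow_eq_zero (α := α) hα ?_
    simp only [Fin.isValue, Fin.sum_univ_four, Matrix.cons_val, Rat.cast_sub, Rat.cast_mul,
      Rat.cast_ofNat, Fin.coe_ofNat_eq_mod, Nat.reduceMod, pow_zero, pow_one, mul_one]
    linear_combination h.2
  have h₁₁ : M 1 1 = 0 := congrFun hc 2
  have h₁₀ : M 1 0 = 0 := congrFun hc 3
  exact h.1 (by simp [h₁₀, h₁₁])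

theorem not_moebiusMaps_of_aeval_sinQuarticSixty (hα : 4 ≤ (minpoly ℚ α).natDegree)
    (hroot : aeval α sinQuarticSixty = 0) : ¬MoebiusMaps M α (-α ^ 3 + α ^ 2 + 3 * α - 2) := by
  intro h
  rw [aeval_sinQuarticSixty] at hroot
  have hc : ![M 0 1 + 2 * M 1 1 - M 1 0, M 0 0 + 6 * M 1 0 - 3 * M 1 1, M 1 0 - M 1 1,
      M 1 1 - 2 * M 1 0] = 0 := by
    refine eq_zero_of_sum_mul_pow_eq_zero (α := α) hα ?_
    simp only [Fin.isValue, Fin.sum_univ_four, Matrix.cons_val, Rat.cast_sub, Rat.cast_add,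
      Rat.cast_mul, Rat.cast_ofNat, Fin.coe_ofNat_eq_mod, Nat.reduceMod, pow_zero, pow_one, mul_one]
    linear_combination h.2 - (M 1 0 : K) * hroot
  have h₂ : M 1 0 - M 1 1 = 0 := congrFun hc 2
  have h₃ : M 1 1 - 2 * M 1 0 = 0 := congrFun hc 3
  have h₁₀ : M 1 0 = 0 := by linarith
  have h₁₁ : M 1 1 = 0 := by linarith
  exact h.1 (by simp [h₁₀, h₁₁])

theorem RealizesFormAbsAut.of_minpoly_eq_sinQuarticSixty (h : minpoly ℚ α = sinQuarticSixty) :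
    RealizesFormAbsAut (glMatrices (glSpan {!![1, 2; -1, -1]})) α := by
  intro M hM
  have hdeg : (minpoly ℚ α).natDegree = 4 := h ▸ natDegree_sinQuarticSixty
  obtain ⟨β, hβ, hMβ⟩ := exists_isConjRoot_moebiusMaps (by lia) hM
  have hαr : aeval α sinQuarticSixty = 0 := h ▸ minpoly.aeval ℚ α
  have hβr : aeval β sinQuarticSixty = 0 := by rw [← h, show _ = _ from hβ, minpoly.aeval]
  rcases eq_or_eq_of_isRoot_sinQuarticSixty hαr hβr with (hβ | hβ) | rfl | rfl
  · exact ⟨1, one_mem _, β, hMβ, hβ ▸ .one α⟩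
  · refine ⟨!![1, 2; -1, -1], mem_glMatrices_glSpan rfl (by norm_num), β, hMβ, ?_, ?_⟩ <;>
      simp only [Matrix.of_apply, Matrix.cons_val] <;> push_cast
    · intro hden
      refine ne_ratCast_of_one_lt_natDegree (α := α) (by lia) (-1) ?_
      push_cast
      linear_combination -hden
    · rw [aeval_sinQuarticSixty] at hαr
      linear_combination (α + 1) * hβ + hαr
  · exact (not_moebiusMaps_two_sub_sq hdeg.ge hMβ).elim
  · exact (not_moebiusMaps_of_aeval_sinQuarticSixty hdeg.ge hαr hMβ).elim

theorem formAut_eq_of_minpoly_eq_sinQuarticSixty (h : minpoly ℚ α = sinQuarticSixty) :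
    formAut (minpolyForm α) = glMatrices (glSpan {!![1, 2; -1, -1]}) :=
  (RealizesFormAbsAut.of_minpoly_eq_sinQuarticSixty h).formAut_eq_of_neg_one_mem
    (by rw [h, natDegree_sinQuarticSixty]; norm_num)
    (glMatrices_le_formAut_of_minpoly_eq_sinQuarticSixty h) neg_one_mem_glMatrices_sixty

theorem formAbsAut_eq_of_minpoly_eq_sinQuarticSixty (h : minpoly ℚ α = sinQuarticSixty) :
    formAbsAut (minpolyForm α) = glMatrices (glSpan {!![1, 2; -1, -1]}) :=
  (RealizesFormAbsAut.of_minpoly_eq_sinQuarticSixty h).formAbsAut_eq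
    (by rw [h, natDegree_sinQuarticSixty]; norm_num)
    ((glMatrices_le_formAut_of_minpoly_eq_sinQuarticSixty h).trans (formAut_le_formAbsAut _))
    neg_one_mem_glMatrices_sixty

end Quartics

section SmallOrders

open Polynomial

variable {K : Type*} [Field K] {ζ : K} {n : ℕ}

theorem sinPoly_eq_of_monic [CharZero K] (hn : 4 < n) (hζ : IsPrimitiveRoot ζ (sinOrder n))
    {p : ℚ[X]} (hp : p.Monic) (hroot : aeval (ζ + ζ⁻¹) p = 0) (hdeg : p.natDegree ≤ sinDegree n) :
    sinPoly n = p := by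
  rw [← natDegree_sinPoly hn, sinPoly_eq_minpoly_add_inv hζ] at hdeg
  rw [sinPoly_eq_minpoly_add_inv hζ]
  exact minpoly_eq_of_natDegree_le hp hroot hdeg

theorem pow_add_one_ne_zero_of_isPrimitiveRoot {N k : ℕ} (hζ : IsPrimitiveRoot ζ N) (hk : k ≠ 0)
    (hkN : k * 2 < N) : ζ ^ k + 1 ≠ 0 := by
  intro h
  refine hζ.pow_ne_one_of_pos_of_lt (mul_ne_zero hk two_ne_zero) hkN ?_
  rw [pow_mul, eq_neg_of_add_eq_zero_left h, neg_one_sq]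

theorem sinPoly_twenty_eight : sinPoly 28 = simplestCubic (-1) := by
  have hN : sinOrder 28 = 2 * 7 := by norm_num [sinOrder]
  have hζ := Complex.isPrimitiveRoot_exp (2 * 7) (by norm_num)
  set ζ := Complex.exp (2 * Real.pi * Complex.I / (2 * 7 : ℕ))
  have hζ₀ : ζ ≠ 0 := Complex.exp_ne_zero _
  have hpow := pow_eq_neg_one_of_isPrimitiveRoot_two_mul hζ
  have hcyc : ζ ^ 6 - ζ ^ 5 + ζ ^ 4 - ζ ^ 3 + ζ ^ 2 - ζ + 1 = 0 := by
    refine mul_left_cancel₀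
      (pow_add_one_ne_zero_of_isPrimitiveRoot hζ one_ne_zero (by norm_num)) ?_
    linear_combination hpow
  refine sinPoly_eq_of_monic (by norm_num) (hN ▸ hζ) (monic_simplestCubic _) ?_ ?_
  · rw [aeval_simplestCubic]
    field_simp
    push_cast
    linear_combination hcyc
  · rw [natDegree_simplestCubic, sinDegree_of_mod_eight_eq_four rfl]
    decide

theorem sinPoly_thirty_six : sinPoly 36 = simplestCubic 0 := by
  have hN : sinOrder 36 = 9 := by norm_num [sinOrder]
  have hζ := Complex.isPrimitiveRoot_exp 9 (by norm_num)
  set ζ := Complex.exp (2 * Real.pi * Complex.I / (9 : ℕ))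
  have hζ₀ : ζ ≠ 0 := Complex.exp_ne_zero _
  have hζ₃ : ζ ^ 3 - 1 ≠ 0 :=
    sub_ne_zero.mpr (hζ.pow_ne_one_of_pos_of_lt (by norm_num) (by norm_num))
  have hcyc : ζ ^ 6 + ζ ^ 3 + 1 = 0 := by
    refine mul_left_cancel₀ hζ₃ ?_
    linear_combination hζ.pow_eq_one
  refine sinPoly_eq_of_monic (by norm_num) (hN ▸ hζ) (monic_simplestCubic _) ?_ ?_
  · rw [aeval_simplestCubic]
    field_simp
    push_cast
    linear_combination hcyc
  · rw [natDegree_simplestCubic, sinDegree_of_mod_eight_eq_four rfl]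
    decide

theorem exists_sinPoly_eq_simplestCubic (hn : n = 28 ∨ n = 36) :
    ∃ a, sinPoly n = simplestCubic a := by
  rcases hn with rfl | rfl
  exacts [⟨_, sinPoly_twenty_eight⟩, ⟨_, sinPoly_thirty_six⟩]

theorem sinPoly_twenty_four : sinPoly 24 = evenReciprocalQuartic (-4) := by
  have hN : sinOrder 24 = 2 * 12 := by norm_num [sinOrder]
  have hζ := Complex.isPrimitiveRoot_exp (2 * 12) (by norm_num)
  set ζ := Complex.exp (2 * Real.pi * Complex.I / (2 * 12 : ℕ))
  have hζ₀ : ζ ≠ 0 := Complex.exp_ne_zero _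
  have hpow := pow_eq_neg_one_of_isPrimitiveRoot_two_mul hζ
  have hcyc : ζ ^ 8 - ζ ^ 4 + 1 = 0 := by
    refine mul_left_cancel₀
      (pow_add_one_ne_zero_of_isPrimitiveRoot hζ (k := 4) (by norm_num) (by norm_num)) ?_
    linear_combination hpow
  refine sinPoly_eq_of_monic (by norm_num) (hN ▸ hζ) (monic_evenReciprocalQuartic _) ?_ ?_
  · rw [aeval_evenReciprocalQuartic]
    field_simp
    push_cast
    linear_combination hcyc
  · rw [natDegree_evenReciprocalQuartic, sinDegree_of_mod_eight_eq_zero rfl]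
    decide

theorem sinPoly_sixty : sinPoly 60 = sinQuarticSixty := by
  have hN : sinOrder 60 = 2 * 15 := by norm_num [sinOrder]
  have hζ := Complex.isPrimitiveRoot_exp (2 * 15) (by norm_num)
  set ζ := Complex.exp (2 * Real.pi * Complex.I / (2 * 15 : ℕ))
  have hζ₀ : ζ ≠ 0 := Complex.exp_ne_zero _
  have hpow := pow_eq_neg_one_of_isPrimitiveRoot_two_mul hζ
  have hcyc : ζ ^ 8 + ζ ^ 7 - ζ ^ 5 - ζ ^ 4 - ζ ^ 3 + ζ + 1 = 0 := by
    refine mul_left_cancel₀ (mul_ne_zero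
      (pow_add_one_ne_zero_of_isPrimitiveRoot hζ (k := 3) (by norm_num) (by norm_num))
      (pow_add_one_ne_zero_of_isPrimitiveRoot hζ (k := 5) (by norm_num) (by norm_num))) ?_
    linear_combination (ζ + 1) * hpow
  refine sinPoly_eq_of_monic (by norm_num) (hN ▸ hζ) monic_sinQuarticSixty ?_ ?_
  · rw [aeval_sinQuarticSixty]
    field_simp
    linear_combination hcyc
  · rw [natDegree_sinQuarticSixty, sinDegree_of_mod_eight_eq_four rfl]
    decide

end SmallOrders

section SineForms

variable {n : ℕ}

theorem four_lt_of_three_le_sinDegree (hd : 3 ≤ sinDegree n) : 4 < n := by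
  by_contra! hn
  revert hd
  unfold sinDegree
  interval_cases n <;> decide

theorem exists_sinOrder_eq_four_mul (hn : n % 8 ≠ 4) (hn₂₄ : n ≠ 24) (hd : 3 ≤ sinDegree n) :
    ∃ w, sinOrder n = 4 * w ∧ (w = 4 ∨ w = 5 ∨ 4 < sinDegree n) := by
  have hpos : 0 < n := zero_lt_four.trans (four_lt_of_three_le_sinDegree hd)
  obtain ⟨w, hw⟩ := (four_dvd_sinOrder_iff hpos).mpr hn
  refine ⟨w, hw, ?_⟩
  by_contra! h
  have hdec : ∀ n ∈ ({1, 2, 3, 4, 5, 6, 8, 10, 12, 16, 20, 24, 28, 36, 60} : Finset ℕ),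
      n % 8 ≠ 4 → n ≠ 24 → 3 ≤ sinDegree n → n = 5 ∨ n = 10 ∨ n = 16 := by
    unfold sinDegree
    decide
  rcases hdec n (mem_of_sinDegree_lt_five hpos (by lia)) hn hn₂₄ hd with rfl | rfl | rfl
  · exact h.2.1 (by have := sinOrder_of_odd (n := 5) (by decide); lia)
  · exact h.2.1 (by have := sinOrder_two_mul_of_odd (m := 5) (by decide); lia)
  · exact h.1 (by have := sinOrder_eight_mul (k := 2) two_pos; lia)

section Cyclotomic

variable {K : Type*} [Field K] [CharZero K] {ζ : K}

theorem natDegree_minpoly_add_inv_sinOrder (hn : 4 < n)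
    (hζ : IsPrimitiveRoot ζ (sinOrder n)) : (minpoly ℚ (ζ + ζ⁻¹)).natDegree = sinDegree n := by
  rw [← sinPoly_eq_minpoly_add_inv hζ, natDegree_sinPoly hn]

theorem isConjRoot_neg_add_inv_sinOrder (hpos : 0 < n) (hn : n % 8 ≠ 4)
    (hζ : IsPrimitiveRoot ζ (sinOrder n)) : IsConjRoot ℚ (ζ + ζ⁻¹) (-(ζ + ζ⁻¹)) := by
  obtain ⟨w, hw⟩ := (four_dvd_sinOrder_iff hpos).mpr hn
  have : NeZero w := ⟨by rintro rfl; exact NeZero.ne (sinOrder n) hw⟩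
  exact isConjRoot_neg_add_inv (hw ▸ hζ)

variable [IsCyclotomicExtension {sinOrder n} ℚ K]

theorem realizesFormAbsAut_bot (hn : n % 8 = 4) (hd : 5 ≤ sinDegree n)
    (hζ : IsPrimitiveRoot ζ (sinOrder n)) : RealizesFormAbsAut ⊥ (ζ + ζ⁻¹) := by
  have hn₄ : 4 < n := four_lt_of_three_le_sinDegree (by lia)
  have := IsCyclotomicExtension.isAbelianGalois {sinOrder n} ℚ K
  have h4 : ¬4 ∣ sinOrder n := (four_dvd_sinOrder_iff (by lia)).not.mpr (not_not.mpr hn)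
  obtain ⟨ε, hε, hsq⟩ := exists_isConjRoot_sq_sub_two h4 hζ
  refine .of_sq_sub_two ?_ hε hsq
  rwa [natDegree_minpoly_add_inv_sinOrder hn₄ hζ]

theorem realizesFormAbsAut_diagonal (hn : n % 8 ≠ 4) (hn₂₄ : n ≠ 24) (hd : 3 ≤ sinDegree n)
    (hζ : IsPrimitiveRoot ζ (sinOrder n)) :
    RealizesFormAbsAut (glMatrices (glSpan {!![-1, 0; 0, 1], !![1, 0; 0, -1]})) (ζ + ζ⁻¹) := by
  have hn₄ := four_lt_of_three_le_sinDegree hd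
  have := IsCyclotomicExtension.isAbelianGalois {sinOrder n} ℚ K
  have := IsCyclotomicExtension.finiteDimensional {sinOrder n} ℚ K
  obtain ⟨w, hw, hcases⟩ := exists_sinOrder_eq_four_mul hn hn₂₄ hd
  have : NeZero w := ⟨by rintro rfl; exact NeZero.ne (sinOrder n) hw⟩
  rw [← natDegree_minpoly_add_inv_sinOrder hn₄ hζ] at hd hcases
  exact .diagonal hd (isConjRoot_neg_add_inv_sinOrder (by lia) hn hζ)
    (exists_isConjRoot_mul_apply_ne (hw ▸ hζ) hd hcases)

end Cyclotomic

theorem formAut_sinForm_of_odd_sinDegree (hn : n % 8 = 4) (hd : 5 ≤ sinDegree n)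
    (hodd : Odd (sinDegree n)) : formAut (sinForm n) = glMatrices groupC1 := by
  have hζ := IsCyclotomicExtension.zeta_spec (sinOrder n) ℚ (CyclotomicField (sinOrder n) ℚ)
  have hdeg :=
    natDegree_minpoly_add_inv_sinOrder (four_lt_of_three_le_sinDegree (by lia : 3 ≤ sinDegree n)) hζ
  rw [sinForm_eq_minpolyForm hζ, glMatrices_groupC1]
  exact (realizesFormAbsAut_bot hn hd hζ).formAut_eq_of_odd (by lia) bot_le (hdeg ▸ hodd)

theorem formAut_sinForm_of_even_sinDegree (hn : n % 8 = 4) (hd : 5 ≤ sinDegree n)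
    (heven : Even (sinDegree n)) : formAut (sinForm n) = glMatrices groupC2 := by
  have hζ := IsCyclotomicExtension.zeta_spec (sinOrder n) ℚ (CyclotomicField (sinOrder n) ℚ)
  have hdeg :=
    natDegree_minpoly_add_inv_sinOrder (four_lt_of_three_le_sinDegree (by lia : 3 ≤ sinDegree n)) hζ
  rw [sinForm_eq_minpolyForm hζ]
  refine ((realizesFormAbsAut_bot hn hd hζ).mono bot_le).formAut_eq_of_neg_one_mem (by lia)
    (glMatrices_glSpan_le_formAut ?_) neg_one_mem_glMatrices_groupC2
  rw [neg_one_fin_two, Set.singleton_subset_iff]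
  exact neg_one_mem_formAut (isHomogeneous_minpolyForm _) (hdeg ▸ heven)

theorem formAbsAut_sinForm_of_mod_eight_eq_four (hn : n % 8 = 4) (hd : 5 ≤ sinDegree n) :
    formAbsAut (sinForm n) = glMatrices groupC2 := by
  have hζ := IsCyclotomicExtension.zeta_spec (sinOrder n) ℚ (CyclotomicField (sinOrder n) ℚ)
  have hdeg :=
    natDegree_minpoly_add_inv_sinOrder (four_lt_of_three_le_sinDegree (by lia : 3 ≤ sinDegree n)) hζ
  rw [sinForm_eq_minpolyForm hζ]
  refine ((realizesFormAbsAut_bot hn hd hζ).mono bot_le).formAbsAut_eq (by lia)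
    (glMatrices_glSpan_le_formAbsAut ?_) neg_one_mem_glMatrices_groupC2
  rw [neg_one_fin_two, Set.singleton_subset_iff]
  exact neg_one_mem_formAbsAut (isHomogeneous_minpolyForm _)

theorem formAut_sinForm_of_mod_eight_ne_four (hn : n % 8 ≠ 4) (hn₂₄ : n ≠ 24)
    (hd : 3 ≤ sinDegree n) :
    formAut (sinForm n) = glMatrices (glSpan {!![-1, 0; 0, 1], !![1, 0; 0, -1]}) := by
  have hζ := IsCyclotomicExtension.zeta_spec (sinOrder n) ℚ (CyclotomicField (sinOrder n) ℚ)
  have hn₄ := four_lt_of_three_le_sinDegree hd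
  have hdeg := natDegree_minpoly_add_inv_sinOrder hn₄ hζ
  rw [sinForm_eq_minpolyForm hζ]
  exact (realizesFormAbsAut_diagonal hn hn₂₄ hd hζ).formAut_eq_of_neg_one_mem (by lia)
    (glMatrices_diagonal_le_formAut (by lia)
      (isConjRoot_neg_add_inv_sinOrder (by lia) hn hζ)) neg_one_mem_glMatrices_diagonal

end SineForms

theorem corollary1p2 (n : ℕ) (hpos : 0 < n)
    (hn : n ∉ ({1, 2, 3, 4, 6, 8, 12, 20} : Finset ℕ)) :
    -- the degree
    ((sinPoly n).natDegree = sinDegree n ∧ 3 ≤ sinDegree n) ∧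
    -- part 1
    (n % 8 = 4 → 5 ≤ sinDegree n → Odd (sinDegree n) →
      (formAut (sinForm n) : Set (Matrix (Fin 2) (Fin 2) ℚ)) = {1} ∧
      Nonempty (formAut (sinForm n) ≃* groupC1) ∧
      (formAbsAut (sinForm n) : Set (Matrix (Fin 2) (Fin 2) ℚ)) = {1, -1} ∧
      Nonempty (formAbsAut (sinForm n) ≃* groupC2)) ∧
    -- part 2
    (n % 8 = 4 → 6 ≤ sinDegree n → Even (sinDegree n) →
      (formAut (sinForm n) : Set (Matrix (Fin 2) (Fin 2) ℚ)) = {1, -1} ∧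
      (formAbsAut (sinForm n) : Set (Matrix (Fin 2) (Fin 2) ℚ)) = {1, -1} ∧
      Nonempty (formAut (sinForm n) ≃* groupC2)) ∧
    -- part 3
    (n % 8 ≠ 4 → n ≠ 24 →
      formAut (sinForm n) = glMatrices (glSpan {!![-1, 0; 0, 1], !![1, 0; 0, -1]}) ∧
      Nonempty (formAut (sinForm n) ≃* groupD2)) ∧
    -- part 4
    ((n = 28 ∨ n = 36) →
      formAut (sinForm n) = glMatrices (glSpan {!![-1, 1; -1, 0]}) ∧
      IsGLConj (formAut (sinForm n)) groupC3 ∧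
      formAbsAut (sinForm n) = glMatrices (glSpan {!![-1, 1; -1, 0], !![-1, 0; 0, -1]}) ∧
      IsGLConj (formAbsAut (sinForm n)) groupC6) ∧
    (n = 60 →
      formAut (sinForm n) = glMatrices (glSpan {!![1, 2; -1, -1]}) ∧
      formAbsAut (sinForm n) = glMatrices (glSpan {!![1, 2; -1, -1]}) ∧
      IsGLConj (formAut (sinForm n)) groupC4 ∧
      IsGLConj (formAbsAut (sinForm n)) groupC4) ∧
    (n = 24 →
      formAut (sinForm n) = glMatrices (glSpan {!![0, 1; 1, 0], !![0, 1; -1, 0]}) ∧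
      formAbsAut (sinForm n) = glMatrices (glSpan {!![0, 1; 1, 0], !![0, 1; -1, 0]}) ∧
      IsGLConj (formAut (sinForm n)) groupD4 ∧
      IsGLConj (formAbsAut (sinForm n)) groupD4) := by
  have hd := three_le_sinDegree hpos hn
  refine ⟨⟨natDegree_sinPoly (four_lt_of_three_le_sinDegree hd), hd⟩, fun h8 hd₅ hodd ↦ ?_,
    fun h8 hd₆ heven ↦ ?_, fun h8 hn₂₄ ↦ ?_, fun h ↦ ?_, ?_, ?_⟩
  · rw [formAut_sinForm_of_odd_sinDegree h8 hd₅ hodd,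
      formAbsAut_sinForm_of_mod_eight_eq_four h8 hd₅]
    exact ⟨by rw [glMatrices_groupC1, Submonoid.coe_bot],
      (isGLConj_glMatrices _).nonempty_mulEquiv, coe_glMatrices_groupC2,
      (isGLConj_glMatrices _).nonempty_mulEquiv⟩
  · rw [formAut_sinForm_of_even_sinDegree h8 (by lia) heven,
      formAbsAut_sinForm_of_mod_eight_eq_four h8 (by lia)]
    exact ⟨coe_glMatrices_groupC2, coe_glMatrices_groupC2,
      (isGLConj_glMatrices _).nonempty_mulEquiv⟩
  · rw [formAut_sinForm_of_mod_eight_ne_four h8 hn₂₄ hd]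
    exact ⟨rfl, isGLConj_diagonal_groupD2.nonempty_mulEquiv⟩
  · obtain ⟨a, ha⟩ := exists_sinPoly_eq_simplestCubic h
    have hAut := formAut_eq_of_minpoly_eq_simplestCubic ha
    have hAbsAut := formAbsAut_eq_of_minpoly_eq_simplestCubic ha
    exact ⟨hAut, hAut ▸ isGLConj_groupC3, hAbsAut, hAbsAut ▸ isGLConj_groupC6⟩
  · rintro rfl
    have hAut := formAut_eq_of_minpoly_eq_sinQuarticSixty sinPoly_sixty
    have hAbsAut := formAbsAut_eq_of_minpoly_eq_sinQuarticSixty sinPoly_sixty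
    exact ⟨hAut, hAbsAut, hAut ▸ isGLConj_groupC4, hAbsAut ▸ isGLConj_groupC4⟩
  · rintro rfl
    have hAut := formAut_eq_of_minpoly_eq_evenReciprocalQuartic sinPoly_twenty_four
    have hAbsAut := formAbsAut_eq_of_minpoly_eq_evenReciprocalQuartic sinPoly_twenty_four
    exact ⟨hAut, hAbsAut, hAut ▸ isGLConj_glMatrices _, hAbsAut ▸ isGLConj_glMatrices _⟩
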